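/- Let $\kappa$ be an infinite regular cardinal; "$\kappa$-ary" means "of size $<\kappa$". A $\kappa$-Boolean algebra is a Boolean algebra in which every set of fewer than $\kappa$ elements has a join; $\kappa\mathsf{Bool}$ is the category of $\kappa$-Boolean algebras and Boolean homomorphisms preserving $\kappa$-ary joins. A $\kappa$-Boolean algebra is $\kappa$-presented if it is isomorphic to $K(X)/{\sim}$, where $K(X)$ is the free $\kappa$-Boolean algebra on a set $X$ with $|X|<\kappa$ and $\sim$ is a $\kappa$-Boolean algebra congruence generated by fewer than $\kappa$ pairs; $\kappa\mathsf{Bool}_\kappa\subseteq\kappa\mathsf{Bool}$ is the full subcategory of $\kappa$-presented algebras. A category is $\kappa$-complete if it has all $\kappa$-ary limits. A category $\mathsf C$ is $\kappa$-extensive if it has finite limits and $\kappa$-ary coproducts, and these coproducts are pullback-stable (for every $f:Y\to\bigsqcup_i X_i$, the pullbacks $f^*(X_i)\to Y$ of the injections exhibit $Y$ as the coproduct $\bigsqcup_i f^*(X_i)$) and disjoint (the injections are monic, and the pullback of the injections of two distinct indices is initial). It is $\kappa$-subextensive if it has finite limits and a strict initial object, and every $\kappa$-ary family of pairwise disjoint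 subobjects of an object $X$ has a join in the poset $\mathrm{Sub}(X)$ that is preserved by pullback along every morphism $Y\to X$. It is Boolean if it is $\kappa$-subextensive and for every object $X$ the poset $\mathrm{Sub}(X)$ is a $\kappa$-complete Boolean algebra. Then: 1. For every $\kappa$-ary family $(A_i)_{i\in I}$ of $\kappa$-presented $\kappa$-Boolean algebras, the product $\prod_{i} A_i$ in $\kappa\mathsf{Bool}$ exists and is $\kappa$-presented. 2. The categories $\kappa\mathsf{Bool}^{\mathrm{op}}$ and $\kappa\mathsf{Bool}_\kappa^{\mathrm{op}}$ are $\kappa$-extensive. 3. Hence $\kappa\mathsf{Bool}_\kappa^{\mathrm{op}}$ is a $\kappa$-complete Boolean $\kappa$-extensive category. -/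

import Mathlib

open CategoryTheory CategoryTheory.Limits Opposite

universe u v w

/-! ### κ-complete Boolean algebras and their homomorphisms -/

/-- The poset `P` has joins of all families of fewer than `κ` elements. -/
def HasKJoins (κ : Cardinal.{u}) (P : Type v) [PartialOrder P] : Prop :=
  ∀ s : Set P, HasCardinalLT s κ → ∃ a, IsLUB s a

/-- The poset `P` is a `κ`-complete Boolean algebra. -/
def IsKBooleanPoset (κ : Cardinal.{u}) (P : Type v) [PartialOrder P] : Prop :=
  HasKJoins κ P ∧ ∃ (B : Type v) (_ : BooleanAlgebra B), Nonempty (P ≃o B)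

/-- A `κ`-complete Boolean algebra. -/
structure KBool (κ : Cardinal.{u}) : Type (u + 1) where
  carrier : Type u
  [str : BooleanAlgebra carrier]
  hasKJoins : HasKJoins κ carrier

namespace KBool

instance (κ : Cardinal.{u}) : CoeSort (KBool κ) (Type u) := ⟨carrier⟩

attribute [instance] KBool.str

/-- Homomorphisms of Boolean algebras preserving joins of fewer than `κ` elements. -/
@[ext]
structure Hom {κ : Cardinal.{u}} (A B : KBool κ) : Type u where
  hom : BoundedLatticeHom A B
  map_isLUB : ∀ (s : Set A) (a : A), HasCardinalLT s κ → IsLUB s a → IsLUB (hom '' s) (hom a)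

instance {κ : Cardinal.{u}} (A B : KBool κ) : CoeFun (Hom A B) (fun _ => A → B) := ⟨fun f => f.hom⟩

/-- The category `κBool`. -/
instance category (κ : Cardinal.{u}) : Category.{u} (KBool κ) where
  Hom A B := Hom A B
  id A := ⟨BoundedLatticeHom.id A, fun s a _ h => by simpa using h⟩
  comp f g := ⟨g.hom.comp f.hom, fun s a hs h => by
    have h1 := g.map_isLUB _ _
      (hs.of_surjective (fun x : s => (⟨f.hom x, x, x.2, rfl⟩ : f.hom '' s))
        (by rintro ⟨_, x, hx, rfl⟩; exact ⟨⟨x, hx⟩, rfl⟩)) (f.map_isLUB s a hs h)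
    rw [Set.image_image] at h1
    simpa using h1⟩

end KBool

/-! ### Free κ-complete Boolean algebras, as Lindenbaum-Tarski algebras -/

/-- Terms in the language of `κ`-complete Boolean algebras, with variables from `X`.
Since every set of cardinality less than `κ` is in bijection with a subset of a fixed set `κ.out`
of cardinality `κ`, it suffices to form joins of families indexed by subsets of `κ.out`. -/
inductive KTerm (κ : Cardinal.{u}) (X : Type u) : Type u
  | var (x : X) : KTerm κ X
  | top : KTerm κ X
  | bot : KTerm κ X
  | compl (s : KTerm κ X) : KTerm κ X
  | sup (s t : KTerm κ X) : KTerm κ X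
  | inf (s t : KTerm κ X) : KTerm κ X
  | join (S : Set κ.out) (hS : HasCardinalLT S κ) (f : S → KTerm κ X) : KTerm κ X

/-- The inequalities between terms that are derivable from the axioms of `κ`-complete
Boolean algebras. -/
inductive KTerm.Le {κ : Cardinal.{u}} {X : Type u} : KTerm κ X → KTerm κ X → Prop
  | refl (s) : Le s s
  | trans {r s t} : Le r s → Le s t → Le r t
  | le_top (s) : Le s top
  | bot_le (s) : Le bot s
  | le_sup_left (s t) : Le s (sup s t)
  | le_sup_right (s t) : Le t (sup s t)
  | sup_le {r s t} : Le r t → Le s t → Le (sup r s) t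
  | inf_le_left (s t) : Le (inf s t) s
  | inf_le_right (s t) : Le (inf s t) t
  | le_inf {r s t} : Le r s → Le r t → Le r (inf s t)
  | distrib (r s t) : Le (inf r (sup s t)) (sup (inf r s) (inf r t))
  | inf_compl_le_bot (s) : Le (inf s (compl s)) bot
  | top_le_sup_compl (s) : Le top (sup s (compl s))
  | le_join {S : Set κ.out} {hS : HasCardinalLT S κ} (f : S → KTerm κ X) (i : S) : Le (f i) (join S hS f)
  | join_le {S : Set κ.out} {hS : HasCardinalLT S κ} {f : S → KTerm κ X} {t} :
      (∀ i, Le (f i) t) → Le (join S hS f) t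

namespace KTerm

variable {κ : Cardinal.{u}} {X : Type u}

instance : Preorder (KTerm κ X) where
  le := Le
  le_refl := Le.refl
  le_trans _ _ _ := Le.trans

theorem Le.compl_anti {s t : KTerm κ X} (h : Le s t) : Le (compl t) (compl s) :=
  -- `tᶜ ≤ tᶜ ⊓ (s ⊔ sᶜ) ≤ (tᶜ ⊓ s) ⊔ (tᶜ ⊓ sᶜ) ≤ sᶜ`
  ((Le.le_inf (Le.refl _) ((Le.le_top _).trans (Le.top_le_sup_compl s))).trans
    (Le.distrib _ _ _)).trans
    (Le.sup_le
      (((Le.le_inf ((Le.inf_le_right _ _).trans h) (Le.inf_le_left _ _)).trans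
        (Le.inf_compl_le_bot t)).trans (Le.bot_le _))
      (Le.inf_le_right _ _))

end KTerm

/-- The free `κ`-complete Boolean algebra on `X`: terms modulo derivable equality. -/
def KFree (κ : Cardinal.{u}) (X : Type u) : Type u :=
  Antisymmetrization (KTerm κ X) (· ≤ ·)

namespace KFree

variable {κ : Cardinal.{u}} {X : Type u}

instance : PartialOrder (KFree κ X) :=
  inferInstanceAs (PartialOrder (Antisymmetrization (KTerm κ X) (· ≤ ·)))

/-- The class of a term. -/
def mk (s : KTerm κ X) : KFree κ X := toAntisymmetrization (· ≤ ·) s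

theorem mk_surjective : Function.Surjective (mk : KTerm κ X → KFree κ X) :=
  fun a => Quotient.exists_rep a

theorem mk_le_mk {s t : KTerm κ X} : mk s ≤ mk t ↔ KTerm.Le s t := Iff.rfl

instance : Top (KFree κ X) := ⟨mk .top⟩

instance : Bot (KFree κ X) := ⟨mk .bot⟩

instance : Compl (KFree κ X) :=
  ⟨Quotient.map KTerm.compl fun _ _ h => ⟨h.2.compl_anti, h.1.compl_anti⟩⟩

instance : Max (KFree κ X) :=
  ⟨Quotient.map₂ KTerm.sup fun _ _ h _ _ h' =>
    ⟨KTerm.Le.sup_le (KTerm.Le.trans h.1 (KTerm.Le.le_sup_left _ _)) (KTerm.Le.trans h'.1 (KTerm.Le.le_sup_right _ _)),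
      KTerm.Le.sup_le (KTerm.Le.trans h.2 (KTerm.Le.le_sup_left _ _)) (KTerm.Le.trans h'.2 (KTerm.Le.le_sup_right _ _))⟩⟩

instance : Min (KFree κ X) :=
  ⟨Quotient.map₂ KTerm.inf fun _ _ h _ _ h' =>
    ⟨KTerm.Le.le_inf (KTerm.Le.trans (KTerm.Le.inf_le_left _ _) h.1) (KTerm.Le.trans (KTerm.Le.inf_le_right _ _) h'.1),
      KTerm.Le.le_inf (KTerm.Le.trans (KTerm.Le.inf_le_left _ _) h.2) (KTerm.Le.trans (KTerm.Le.inf_le_right _ _) h'.2)⟩⟩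

instance : Lattice (KFree κ X) where
  sup := max
  inf := min
  le_sup_left := by rintro ⟨a⟩ ⟨b⟩; exact KTerm.Le.le_sup_left a b
  le_sup_right := by rintro ⟨a⟩ ⟨b⟩; exact KTerm.Le.le_sup_right a b
  sup_le := by rintro ⟨a⟩ ⟨b⟩ ⟨c⟩ h h'; exact KTerm.Le.sup_le h h'
  inf_le_left := by rintro ⟨a⟩ ⟨b⟩; exact KTerm.Le.inf_le_left a b
  inf_le_right := by rintro ⟨a⟩ ⟨b⟩; exact KTerm.Le.inf_le_right a b
  le_inf := by rintro ⟨a⟩ ⟨b⟩ ⟨c⟩ h h'; exact KTerm.Le.le_inf h h'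

instance : DistribLattice (KFree κ X) :=
  DistribLattice.ofInfSupLe (by rintro ⟨a⟩ ⟨b⟩ ⟨c⟩; exact KTerm.Le.distrib a b c)

instance : BooleanAlgebra (KFree κ X) where
  le_top := by rintro ⟨a⟩; exact KTerm.Le.le_top a
  bot_le := by rintro ⟨a⟩; exact KTerm.Le.bot_le a
  inf_compl_le_bot := by rintro ⟨a⟩; exact KTerm.Le.inf_compl_le_bot a
  top_le_sup_compl := by rintro ⟨a⟩; exact KTerm.Le.top_le_sup_compl a

theorem isLUB_join (S : Set κ.out) (hS : HasCardinalLT S κ) (f : S → KTerm κ X) :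
    IsLUB (Set.range fun i => mk (f i)) (mk (.join S hS f)) := by
  refine ⟨?_, ?_⟩
  · rintro _ ⟨i, rfl⟩
    exact KTerm.Le.le_join f i
  · intro b hb
    obtain ⟨t, rfl⟩ := mk_surjective b
    exact KTerm.Le.join_le fun i => hb ⟨i, rfl⟩

theorem exists_range_eq (s : Set (KFree κ X)) (hs : HasCardinalLT s κ) :
    ∃ (S : Set κ.out) (_ : HasCardinalLT S κ) (f : S → KTerm κ X),
      s = Set.range fun i => mk (f i) := by
  have h : Cardinal.mk s ≤ Cardinal.mk κ.out := by
    rw [Cardinal.mk_out]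
    exact ((hasCardinalLT_iff_cardinal_mk_lt _ _).1 hs).le
  obtain ⟨e⟩ := h
  let e' := Equiv.ofInjective e e.injective
  choose g hg using mk_surjective (κ := κ) (X := X)
  refine ⟨Set.range e, hs.of_surjective e' e'.surjective, fun i => g (e'.symm i), ?_⟩
  ext a
  constructor
  · intro ha
    exact ⟨e' ⟨a, ha⟩, by simp [hg]⟩
  · rintro ⟨i, rfl⟩
    simp [hg]

theorem hasKJoins (κ : Cardinal.{u}) (X : Type u) : HasKJoins κ (KFree κ X) := by
  intro s hs
  obtain ⟨S, hS, f, rfl⟩ := exists_range_eq s hs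
  exact ⟨_, isLUB_join S hS f⟩

end KFree

namespace KBool

variable {κ : Cardinal.{u}}

/-- The free `κ`-complete Boolean algebra on `X`, as an object of `κBool`. -/
abbrev free (κ : Cardinal.{u}) (X : Type u) : KBool κ where
  carrier := KFree κ X
  hasKJoins := KFree.hasKJoins κ X

/-- The generators of the free `κ`-complete Boolean algebra. -/
def free.of (κ : Cardinal.{u}) {X : Type u} (x : X) : free κ X := KFree.mk (.var x)

/-! ### κ-presented algebras -/

/-- `R` is a congruence of the `κ`-complete Boolean algebra `A`. -/
structure IsCongruence (A : KBool κ) (R : A → A → Prop) : Prop where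
  equivalence : Equivalence R
  compl : ∀ a b, R a b → R aᶜ bᶜ
  sup : ∀ a b c d, R a b → R c d → R (a ⊔ c) (b ⊔ d)
  inf : ∀ a b c d, R a b → R c d → R (a ⊓ c) (b ⊓ d)
  join : ∀ (I : Type u), HasCardinalLT I κ → ∀ (a b : I → A) (a' b' : A),
    (∀ i, R (a i) (b i)) → IsLUB (Set.range a) a' → IsLUB (Set.range b) b' → R a' b'

/-- The congruence on `A` generated by a set `r` of pairs. -/
def congruenceGen (A : KBool κ) (r : Set (A × A)) (a b : A) : Prop :=
  ∀ R : A → A → Prop, IsCongruence A R → (∀ p ∈ r, R p.1 p.2) → R a b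

/-- `A` is `κ`-presented: for some set `X` of fewer than `κ` generators and some congruence on the
free algebra on `X` generated by fewer than `κ` pairs, `A` is isomorphic to the quotient, that is,
`A` is the target of a surjective homomorphism whose kernel is this congruence. -/
def IsKPresented (κ : Cardinal.{u}) : ObjectProperty (KBool κ) := fun A =>
  ∃ (X : Type u) (r : Set (free κ X × free κ X)) (p : Hom (free κ X) A),
    HasCardinalLT X κ ∧ HasCardinalLT r κ ∧ Function.Surjective p ∧
      ∀ a b, p a = p b ↔ congruenceGen (free κ X) r a b

end KBool

/-- The category `κBool_κ` of `κ`-presented `κ`-complete Boolean algebras. -/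
abbrev KBoolPresented (κ : Cardinal.{u}) := (KBool.IsKPresented κ).FullSubcategory

/-! ### κ-complete, κ-extensive and Boolean categories -/

/-- `C` has all limits of diagrams with fewer than `κ` morphisms. -/
def IsKComplete (κ : Cardinal.{u}) (C : Type w) [Category.{v} C] : Prop :=
  ∀ (J : Type u) [SmallCategory J], HasCardinalLT (Arrow J) κ → HasLimitsOfShape J C

/-- The coproduct cocone `c` is pullback-stable: pulling back its injections along any morphism
`f : Y ⟶ c.pt` exhibits `Y` as the coproduct of the pullbacks. -/
def IsPullbackStable {C : Type w} [Category.{v} C] {I : Type u} {X : I → C} (c : Cofan X) : Prop :=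
  ∀ (Y : C) (f : Y ⟶ c.pt) (P : I → C) (p : ∀ i, P i ⟶ Y) (q : ∀ i, P i ⟶ X i),
    (∀ i, IsPullback (p i) (q i) f (c.inj i)) → Nonempty (IsColimit (Cofan.mk Y p))

/-- `C` is finitely complete and has pullback-stable and disjoint `κ`-ary coproducts. -/
structure IsKExtensive (κ : Cardinal.{u}) (C : Type w) [Category.{v} C] : Prop where
  hasFiniteLimits : HasFiniteLimits C
  hasCoproduct : ∀ (I : Type u), HasCardinalLT I κ → ∀ X : I → C, HasCoproduct X
  isPullbackStable : ∀ (I : Type u), HasCardinalLT I κ → ∀ (X : I → C) (c : Cofan X),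
    IsColimit c → IsPullbackStable c
  disjoint : ∀ (I : Type u), HasCardinalLT I κ → ∀ X : I → C, CoproductDisjoint X

/-- `C` is finitely complete, has a strict initial object, and any `κ`-ary family of pairwise
disjoint subobjects has a pullback-stable join. (Two subobjects are disjoint when their meet is the
initial object, i.e. when every subobject contained in both is an initial object.) -/
structure IsKSubextensive (κ : Cardinal.{u}) (C : Type w) [Category.{v} C] : Prop where
  hasFiniteLimits : HasFiniteLimits C
  hasInitial : HasInitial C
  hasStrictInitialObjects : HasStrictInitialObjects C
  exists_join : ∀ (I : Type u), HasCardinalLT I κ → ∀ (X : C) (A : I → Subobject X),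
    (∀ i j, i ≠ j → ∀ B : Subobject X, B ≤ A i → B ≤ A j → Nonempty (IsInitial (B : C))) →
      ∃ J : Subobject X, IsLUB (Set.range A) J ∧ ∀ (Y : C) (f : Y ⟶ X),
        IsLUB (Set.range fun i => (Subobject.pullback f).obj (A i)) ((Subobject.pullback f).obj J)

/-- `C` is `κ`-subextensive and every poset of subobjects in `C` is a `κ`-complete Boolean
algebra. -/
structure IsKBooleanCategory (κ : Cardinal.{u}) (C : Type w) [Category.{v} C] : Prop where
  isKSubextensive : IsKSubextensive κ C
  isKBooleanPoset : ∀ X : C, IsKBooleanPoset κ (Subobject X)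

/-! Everything reduces to quotients by a single element. For `e` in `A`, the relation `a ⊓ e = b ⊓
e` is a congruence; it is the one generated by `(e, ⊤)`. A congruence generated by fewer than `κ`
pairs `(aᵢ, bᵢ)` has this form, with `e` the meet of the `aᵢ ⇔ bᵢ` (`congruenceGen_iff`). So the
`κ`-presented algebras are the principal quotients of free algebras on fewer than `κ` generators,
and a surjection between presented algebras is principal (`IsKPresented.exists_isPrincipal`).

Extensivity: the projections of a `κ`-ary product are the principal quotients at the elements of a
partition of unity, and every partition of unity of size less than `κ` gives a product. The pushout
of the quotient at `e` along `f` is the quotient at `f e` (`IsPrincipal.of_isPushout`), and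
homomorphisms preserve partitions of unity. Hence coproducts in the opposite category are stable and
disjoint. Products of presented algebras are presented because finitely many or `κ`-ary many
quotients of one free algebra with suitably disjoint generators `vᵢ` combine into the quotient at
their join (`isKPresented_pi`).

Booleanness: a subobject in the opposite category is an epimorphism of algebras. Epimorphisms are
surjective (`surjective_of_epi`), by an amalgamation argument using regular lower sets of a forcing
poset. Hence subobjects of `A` correspond to elements of `A`, pullback along `f` acts as the
homomorphism `f`, and the required joins and their stability are those of the algebras. -/

open scoped symmDiff

namespace KBool

variable {κ : Cardinal.{u}}

/-! ### Homomorphisms and small joins -/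

section Basic

variable {A B C : KBool κ}

theorem hom_ext {f g : A ⟶ B} (h : ∀ a, f.hom a = g.hom a) : f = g :=
  Hom.ext (DFunLike.ext _ _ h)

@[simp]
theorem comp_hom_apply (f : A ⟶ B) (g : B ⟶ C) (a : A) : (f ≫ g).hom a = g.hom (f.hom a) := rfl

theorem hom_congr {f g : A ⟶ B} (h : f = g) (a : A) : f.hom a = g.hom a := by rw [h]

theorem hom_sup (f : A ⟶ B) (a b : A) : f.hom (a ⊔ b) = f.hom a ⊔ f.hom b := map_sup _ _ _

theorem hom_inf (f : A ⟶ B) (a b : A) : f.hom (a ⊓ b) = f.hom a ⊓ f.hom b := map_inf _ _ _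

theorem hom_compl (f : A ⟶ B) (a : A) : f.hom aᶜ = (f.hom a)ᶜ := map_compl' _ _

theorem hom_top (f : A ⟶ B) : f.hom ⊤ = ⊤ := map_top _

theorem hom_bot (f : A ⟶ B) : f.hom ⊥ = ⊥ := map_bot _

theorem isLUB_range_map (f : A ⟶ B) {I : Type u} (hI : HasCardinalLT I κ) {a : I → A} {a' : A}
    (h : IsLUB (Set.range a) a') : IsLUB (Set.range fun i => f.hom (a i)) (f.hom a') := by
  have := f.map_isLUB _ _ (hI.of_surjective _ Set.rangeFactorization_surjective) h
  rwa [← Set.range_comp] at this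

theorem exists_isLUB {I : Type u} (hI : HasCardinalLT I κ) (a : I → A) :
    ∃ a', IsLUB (Set.range a) a' :=
  A.hasKJoins _ (hI.of_surjective _ Set.rangeFactorization_surjective)

/-- The join of a family of fewer than `κ` elements. -/
noncomputable def kSup {I : Type u} (hI : HasCardinalLT I κ) (a : I → A) : A :=
  (exists_isLUB hI a).choose

variable {I : Type u} (hI : HasCardinalLT I κ)

theorem isLUB_kSup (a : I → A) : IsLUB (Set.range a) (kSup hI a) :=
  (exists_isLUB hI a).choose_spec

theorem le_kSup (a : I → A) (i : I) : a i ≤ kSup hI a := (isLUB_kSup hI a).1 ⟨i, rfl⟩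

theorem kSup_le_iff {a : I → A} {t : A} : kSup hI a ≤ t ↔ ∀ i, a i ≤ t := by
  rw [isLUB_le_iff (isLUB_kSup hI a), mem_upperBounds, Set.forall_mem_range]

/-- Meeting with `b` is left adjoint to `b ⇨ ·`, so it distributes over every join that exists. -/
theorem kSup_inf_le_iff {a : I → A} {b t : A} : kSup hI a ⊓ b ≤ t ↔ ∀ i, a i ⊓ b ≤ t := by
  simp only [← le_himp_iff, kSup_le_iff]

theorem isLUB_inf {a : I → A} {a' : A} (h : IsLUB (Set.range a) a') (b : A) :
    IsLUB (Set.range fun i => a i ⊓ b) (a' ⊓ b) := by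
  refine isLUB_iff_le_iff.2 fun t => ?_
  rw [← le_himp_iff, isLUB_le_iff h]
  simp [mem_upperBounds]

theorem map_kSup (f : A ⟶ B) (a : I → A) :
    f.hom (kSup hI a) = kSup hI fun i => f.hom (a i) :=
  (isLUB_range_map f hI (isLUB_kSup hI a)).unique (isLUB_kSup hI _)

/-- The meet of a family of fewer than `κ` elements. -/
noncomputable def kInf (a : I → A) : A := (kSup hI fun i => (a i)ᶜ)ᶜ

theorem le_kInf_iff {a : I → A} {t : A} : t ≤ kInf hI a ↔ ∀ i, t ≤ a i := by
  rw [kInf, le_compl_comm, kSup_le_iff]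
  simp

theorem kInf_le (a : I → A) (i : I) : kInf hI a ≤ a i := (le_kInf_iff hI).1 le_rfl i

theorem map_kInf (f : A ⟶ B) (a : I → A) :
    f.hom (kInf hI a) = kInf hI fun i => f.hom (a i) := by
  simp [kInf, map_kSup]

theorem kSup_congr {a b : I → A} (h : ∀ i, a i = b i) : kSup hI a = kSup hI b := by
  rw [funext h]

theorem kInf_eq_top {a : I → A} (h : ∀ i, a i = ⊤) : kInf hI a = ⊤ :=
  top_le_iff.1 ((le_kInf_iff hI).2 fun i => (h i).ge)

/-- A homomorphism of bounded lattices is a homomorphism of `κ`-complete Boolean algebras as soon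
as it is compatible with chosen joins. -/
def Hom.ofKSup (φ : BoundedLatticeHom A B)
    (h : ∀ (I : Type u) (hI : HasCardinalLT I κ) (a : I → A) (t : B),
      (∀ i, φ (a i) ≤ t) → φ (kSup hI a) ≤ t) : A ⟶ B where
  hom := φ
  map_isLUB s a hs ha := by
    have ha' : a = kSup hs ((↑) : s → A) := by
      refine ha.unique ?_
      simpa using isLUB_kSup hs ((↑) : s → A)
    refine ⟨?_, fun t ht => ?_⟩
    · rintro _ ⟨x, hx, rfl⟩
      exact OrderHomClass.mono φ (ha.1 hx)
    · rw [ha']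
      exact h s hs _ t fun i => ht ⟨i, i.2, rfl⟩

theorem epi_of_surjective (f : A ⟶ B) (hf : Function.Surjective f.hom) : Epi f where
  left_cancellation g h w := hom_ext fun b => by
    obtain ⟨a, rfl⟩ := hf b
    exact hom_congr w a

/-- A homomorphism factors through a surjective one if it identifies at least as much. -/
theorem exists_desc_of_surjective (q : A ⟶ B) (hq : Function.Surjective q.hom) (f : A ⟶ C)
    (h : ∀ a b, q.hom a = q.hom b → f.hom a = f.hom b) : ∃ g : B ⟶ C, q ≫ g = f := by
  have key : ∀ a, f.hom (Function.surjInv hq (q.hom a)) = f.hom a :=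
    fun a => h _ _ (Function.surjInv_eq hq _)
  let φ : BoundedLatticeHom B C :=
    { toFun := fun b => f.hom (Function.surjInv hq b)
      map_sup' := fun x y => by
        obtain ⟨a, rfl⟩ := hq x
        obtain ⟨b, rfl⟩ := hq y
        rw [← map_sup, key, key, key, map_sup]
      map_inf' := fun x y => by
        obtain ⟨a, rfl⟩ := hq x
        obtain ⟨b, rfl⟩ := hq y
        rw [← map_inf, key, key, key, map_inf]
      map_top' := by rw [← map_top q.hom, key, map_top]
      map_bot' := by rw [← map_bot q.hom, key, map_bot] }
  refine ⟨Hom.ofKSup φ fun I hI b t ht => ?_, hom_ext key⟩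
  choose a ha using fun i => hq (b i)
  obtain rfl : b = fun i => q.hom (a i) := funext fun i => (ha i).symm
  have : φ (kSup hI fun i => q.hom (a i)) = kSup hI fun i => f.hom (a i) := by
    rw [← map_kSup, ← map_kSup]
    exact key _
  rw [this, kSup_le_iff]
  intro i
  rw [← key]
  exact ht i

theorem isIso_of_bijective (f : A ⟶ B) (hf : Function.Bijective f.hom) : IsIso f := by
  obtain ⟨g, hg⟩ := exists_desc_of_surjective f hf.2 (𝟙 A) fun a b h => hf.1 h
  have := epi_of_surjective f hf.2
  exact ⟨g, hg, by rw [← cancel_epi f, reassoc_of% hg, Category.comp_id]⟩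

theorem bijective_of_isIso (f : A ⟶ B) [IsIso f] : Function.Bijective f.hom :=
  ⟨Function.LeftInverse.injective (g := (inv f).hom) (hom_congr (IsIso.hom_inv_id f)),
    Function.RightInverse.surjective (g := (inv f).hom) (hom_congr (IsIso.inv_hom_id f))⟩

end Basic

/-! ### Congruences and quotients -/

section Congruence

variable {A B C : KBool κ}

theorem isCongruence_ker (f : A ⟶ B) : IsCongruence A fun a b => f.hom a = f.hom b where
  equivalence := ⟨fun _ => rfl, Eq.symm, Eq.trans⟩
  compl a b h := by rw [map_compl', map_compl', h]
  sup a b c d h h' := by rw [map_sup, map_sup, h, h']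
  inf a b c d h h' := by rw [map_inf, map_inf, h, h']
  join I hI a b a' b' h ha hb := by
    have h1 := isLUB_range_map f hI ha
    rw [funext h] at h1
    exact h1.unique (isLUB_range_map f hI hb)

theorem isCongruence_inf (u : A) : IsCongruence A fun a b => a ⊓ u = b ⊓ u where
  equivalence := ⟨fun _ => rfl, Eq.symm, Eq.trans⟩
  compl a b h := by
    -- Below `u`, the complement of `x` depends only on `x ⊓ u`.
    have key : ∀ x : A, xᶜ ⊓ u = u \ (x ⊓ u) := fun x => by
      rw [sdiff_inf_self_right, sdiff_eq, inf_comm]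
    rw [key, key, h]
  sup a b c d h h' := by rw [inf_sup_right, inf_sup_right, h, h']
  inf a b c d h h' := by
    rw [inf_inf_distrib_right, h, h', ← inf_inf_distrib_right]
  join I hI a b a' b' h ha hb := by
    have h1 := isLUB_inf ha u
    rw [funext h] at h1
    exact h1.unique (isLUB_inf hb u)

theorem isCongruence_congruenceGen (r : Set (A × A)) : IsCongruence A (congruenceGen A r) where
  equivalence := ⟨fun a _ hR _ => hR.equivalence.refl a,
    fun h R hR hr => hR.equivalence.symm (h R hR hr),
    fun h h' R hR hr => hR.equivalence.trans (h R hR hr) (h' R hR hr)⟩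
  compl _ _ h R hR hr := hR.compl _ _ (h R hR hr)
  sup _ _ _ _ h h' R hR hr := hR.sup _ _ _ _ (h R hR hr) (h' R hR hr)
  inf _ _ _ _ h h' R hR hr := hR.inf _ _ _ _ (h R hR hr) (h' R hR hr)
  join I hI a b a' b' h ha hb R hR hr := hR.join I hI a b a' b' (fun i => h i R hR hr) ha hb

theorem congruenceGen_of_mem {r : Set (A × A)} {p : A × A} (hp : p ∈ r) :
    congruenceGen A r p.1 p.2 := fun _ _ hr => hr p hp

namespace IsCongruence

variable {R : A → A → Prop} (hR : IsCongruence A R)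

/-- The setoid underlying a congruence. -/
def setoid (hR : IsCongruence A R) : Setoid A := ⟨R, hR.equivalence⟩

/-- The type of congruence classes. -/
def Class (hR : IsCongruence A R) : Type u := Quotient hR.setoid

/-- The class of an element. -/
def cls (a : A) : hR.Class := Quotient.mk hR.setoid a

theorem cls_surjective : Function.Surjective hR.cls := fun a => Quotient.exists_rep a

theorem cls_eq_cls {a b : A} : hR.cls a = hR.cls b ↔ R a b := Quotient.eq (r := hR.setoid)

instance : Max hR.Class :=
  ⟨Quotient.map₂ (· ⊔ ·) fun _ _ h _ _ h' => hR.sup _ _ _ _ h h'⟩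

instance : Min hR.Class :=
  ⟨Quotient.map₂ (· ⊓ ·) fun _ _ h _ _ h' => hR.inf _ _ _ _ h h'⟩

instance : Compl hR.Class := ⟨Quotient.map (fun a => aᶜ) fun _ _ h => hR.compl _ _ h⟩

instance : Top hR.Class := ⟨hR.cls ⊤⟩

instance : Bot hR.Class := ⟨hR.cls ⊥⟩

instance : Lattice hR.Class :=
  Lattice.mk'
    (by rintro ⟨a⟩ ⟨b⟩; exact congrArg hR.cls (sup_comm a b))
    (by rintro ⟨a⟩ ⟨b⟩ ⟨c⟩; exact congrArg hR.cls (sup_assoc a b c))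
    (by rintro ⟨a⟩ ⟨b⟩; exact congrArg hR.cls (inf_comm a b))
    (by rintro ⟨a⟩ ⟨b⟩ ⟨c⟩; exact congrArg hR.cls (inf_assoc a b c))
    (by rintro ⟨a⟩ ⟨b⟩; exact congrArg hR.cls (sup_inf_self (a := a) (b := b)))
    (by rintro ⟨a⟩ ⟨b⟩; exact congrArg hR.cls (inf_sup_self (a := a) (b := b)))

theorem cls_le_cls {a b : A} : hR.cls a ≤ hR.cls b ↔ R (a ⊓ b) a := by
  rw [← inf_eq_left, ← hR.cls_eq_cls]
  rfl

theorem cls_mono {a b : A} (h : a ≤ b) : hR.cls a ≤ hR.cls b := by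
  rw [cls_le_cls, inf_eq_left.2 h]
  exact hR.equivalence.refl a

instance : DistribLattice hR.Class :=
  DistribLattice.ofInfSupLe (by
    rintro ⟨a⟩ ⟨b⟩ ⟨c⟩; exact (congrArg hR.cls (inf_sup_left a b c)).le)

instance : BooleanAlgebra hR.Class where
  le_top := by rintro ⟨a⟩; exact hR.cls_mono le_top
  bot_le := by rintro ⟨a⟩; exact hR.cls_mono bot_le
  inf_compl_le_bot := by rintro ⟨a⟩; exact hR.cls_mono (inf_compl_eq_bot (a := a)).le
  top_le_sup_compl := by rintro ⟨a⟩; exact hR.cls_mono (sup_compl_eq_top (x := a)).ge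

/-- An upper bound `cls b` means `a i ⊓ b ∼ a i` for all `i`; closure of the congruence under joins
and distributivity then give `a' ⊓ b ∼ a'`. -/
theorem isLUB_cls {I : Type u} (hI : HasCardinalLT I κ) {a : I → A} {a' : A}
    (h : IsLUB (Set.range a) a') : IsLUB (Set.range fun i => hR.cls (a i)) (hR.cls a') := by
  refine ⟨?_, fun t ht => ?_⟩
  · rintro _ ⟨i, rfl⟩
    exact hR.cls_mono (h.1 ⟨i, rfl⟩)
  · obtain ⟨b, rfl⟩ := hR.cls_surjective t
    exact hR.cls_le_cls.2 (hR.join I hI _ a _ _ (fun i => hR.cls_le_cls.1 (ht ⟨i, rfl⟩))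
      (isLUB_inf h b) h)

/-- The quotient of a `κ`-complete Boolean algebra by a congruence. -/
abbrev quotient : KBool κ where
  carrier := hR.Class
  hasKJoins s hs := by
    choose g hg using hR.cls_surjective
    have h := hR.isLUB_cls hs (isLUB_kSup hs fun x : s => g x)
    simp only [hg, Subtype.range_coe] at h
    exact ⟨_, h⟩

/-- The quotient homomorphism. -/
def proj : A ⟶ hR.quotient :=
  Hom.ofKSup
    { toFun := hR.cls
      map_sup' := fun _ _ => rfl
      map_inf' := fun _ _ => rfl
      map_top' := rfl
      map_bot' := rfl }
    fun _ hI a _ ht => (hR.isLUB_cls hI (isLUB_kSup hI a)).2 (Set.forall_mem_range.2 ht)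

end IsCongruence

theorem exists_quotient {R : A → A → Prop} (hR : IsCongruence A R) :
    ∃ (Q : KBool κ) (q : A ⟶ Q), Function.Surjective q.hom ∧ ∀ a b, q.hom a = q.hom b ↔ R a b :=
  ⟨hR.quotient, hR.proj, hR.cls_surjective, fun _ _ => hR.cls_eq_cls⟩

/-- Every congruence contains, with the pair `(a, b)`, the pair `(a ⇔ b, ⊤)`. -/
theorem IsCongruence.bihimp {R : A → A → Prop} (hR : IsCongruence A R) {a b : A} (h : R a b) :
    R (a ⇔ b) ⊤ := by
  have h1 : hR.proj.hom a = hR.proj.hom b := hR.cls_eq_cls.2 h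
  refine hR.cls_eq_cls.1 (show hR.proj.hom (a ⇔ b) = hR.proj.hom ⊤ from ?_)
  rw [map_bihimp, h1, bihimp_self, map_top]

/-- Both sides equal `a ⊓ b`. -/
theorem inf_bihimp_eq (a b : A) : a ⊓ (a ⇔ b) = b ⊓ (a ⇔ b) := by
  have key : ∀ x y : A, x ⊓ (x ⇔ y) = x ⊓ y := fun x y => by
    rw [bihimp_eq', inf_sup_left, ← inf_assoc, ← inf_assoc, inf_idem, inf_compl_self, bot_inf_eq,
      sup_bot_eq]
  rw [key, bihimp_comm, key, inf_comm]

theorem inf_eq_inf_of_le_bihimp {a b c : A} (h : c ≤ a ⇔ b) : a ⊓ c = b ⊓ c := by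
  rw [← inf_eq_right.2 h, ← inf_assoc, ← inf_assoc, inf_bihimp_eq]

/-- A congruence generated by fewer than `κ` pairs is principal. -/
theorem congruenceGen_iff {I : Type u} (hI : HasCardinalLT I κ) (g : I → A × A) (a b : A) :
    congruenceGen A (Set.range g) a b ↔
      a ⊓ kInf hI (fun i => (g i).1 ⇔ (g i).2) = b ⊓ kInf hI (fun i => (g i).1 ⇔ (g i).2) := by
  constructor
  · intro h
    refine h _ (isCongruence_inf _) ?_
    rintro _ ⟨i, rfl⟩
    exact inf_eq_inf_of_le_bihimp (kInf_le hI (fun i => (g i).1 ⇔ (g i).2) i)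
  · intro h R hR hr
    -- In the quotient by `R` each `aᵢ ⇔ bᵢ` becomes `⊤`, hence so does their meet, which the
    -- projection preserves.
    have h1 : R (kInf hI fun i => (g i).1 ⇔ (g i).2) ⊤ := by
      have := hR.proj
      have h2 : ∀ x y, R x y ↔ hR.proj.hom x = hR.proj.hom y := fun x y => hR.cls_eq_cls.symm
      rw [h2, map_top, map_kInf]
      refine kInf_eq_top hI fun i => ?_
      rw [← map_top hR.proj.hom, ← h2]
      exact hR.bihimp (hr _ ⟨i, rfl⟩)
    have h2 : ∀ x, R (x ⊓ kInf hI fun i => (g i).1 ⇔ (g i).2) x := fun x => by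
      simpa using hR.inf x x _ _ (hR.equivalence.refl x) h1
    exact hR.equivalence.trans (hR.equivalence.symm (h ▸ h2 a)) (h2 b)

end Congruence

end KBool

/-! ### The universal property of the free algebras -/

namespace KTerm

variable {κ : Cardinal.{u}} {X : Type u} {A : KBool κ}

/-- The value of a term under an assignment of its variables. -/
noncomputable def eval (f : X → A) : KTerm κ X → A
  | var x => f x
  | top => ⊤
  | bot => ⊥
  | compl s => (eval f s)ᶜ
  | sup s t => eval f s ⊔ eval f t
  | inf s t => eval f s ⊓ eval f t
  | join _ hS g => KBool.kSup hS fun i => eval f (g i)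

/-- Soundness of the derivation rules, which lets evaluation descend to `KFree`. -/
theorem Le.eval_le (f : X → A) {s t : KTerm κ X} (h : Le s t) : eval f s ≤ eval f t := by
  induction h with
  | refl => exact le_rfl
  | trans _ _ h h' => exact h.trans h'
  | le_top => exact _root_.le_top
  | bot_le => exact _root_.bot_le
  | le_sup_left => exact _root_.le_sup_left
  | le_sup_right => exact _root_.le_sup_right
  | sup_le _ _ h h' => exact _root_.sup_le h h'
  | inf_le_left => exact _root_.inf_le_left
  | inf_le_right => exact _root_.inf_le_right
  | le_inf _ _ h h' => exact _root_.le_inf h h'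
  | distrib r s t => exact (inf_sup_left (eval f r) (eval f s) (eval f t)).le
  | inf_compl_le_bot => exact inf_compl_eq_bot.le
  | top_le_sup_compl => exact sup_compl_eq_top.ge
  | le_join g i => exact KBool.le_kSup _ (fun i => eval f (g i)) i
  | join_le _ h => exact (KBool.kSup_le_iff _).2 h

end KTerm

namespace KBool

variable {κ : Cardinal.{u}}

section Free

variable {X : Type u} {A B : KBool κ}

theorem free.eval_eq_of_rel (f : X → A) {s t : KTerm κ X} (h : AntisymmRel (· ≤ ·) s t) :
    s.eval f = t.eval f :=
  le_antisymm (KTerm.Le.eval_le f h.1) (KTerm.Le.eval_le f h.2)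

/-- The homomorphism from a free algebra determined by the images of the generators. -/
noncomputable def free.lift (f : X → A) : free κ X ⟶ A where
  hom :=
    { toFun := Quotient.lift (KTerm.eval f) fun _ _ h => free.eval_eq_of_rel f h
      map_sup' := by rintro ⟨a⟩ ⟨b⟩; rfl
      map_inf' := by rintro ⟨a⟩ ⟨b⟩; rfl
      map_top' := rfl
      map_bot' := rfl }
  map_isLUB s a hs ha := by
    obtain ⟨S, hS, g, rfl⟩ := KFree.exists_range_eq s hs
    obtain rfl := ha.unique (KFree.isLUB_join S hS g)
    rw [← Set.range_comp]
    exact isLUB_kSup hS fun i => (g i).eval f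

theorem free.hom_ext {f g : free κ X ⟶ A} (h : ∀ x, f.hom (free.of κ x) = g.hom (free.of κ x)) :
    f = g := by
  refine KBool.hom_ext fun a => ?_
  obtain ⟨t, rfl⟩ := KFree.mk_surjective a
  let m (s : KTerm κ X) : free κ X := KFree.mk s
  induction t with
  | var x => exact h x
  | top => exact (hom_top f).trans (hom_top g).symm
  | bot => exact (hom_bot f).trans (hom_bot g).symm
  | compl s hs =>
    exact (hom_compl f (m s)).trans
      ((congrArg compl hs).trans (hom_compl g (m s)).symm)
  | sup s t hs ht =>
    exact (hom_sup f (m s) (m t)).trans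
      ((congrArg₂ (· ⊔ ·) hs ht).trans (hom_sup g (m s) (m t)).symm)
  | inf s t hs ht =>
    exact (hom_inf f (m s) (m t)).trans
      ((congrArg₂ (· ⊓ ·) hs ht).trans (hom_inf g (m s) (m t)).symm)
  | join S hS t ht =>
    have h1 := isLUB_range_map f hS (KFree.isLUB_join S hS t)
    simp only [ht] at h1
    exact h1.unique (isLUB_range_map g hS (KFree.isLUB_join S hS t))

/-- The free algebra, as an object whose underlying type does not unfold. -/
def freeAlgebra (κ : Cardinal.{u}) (X : Type u) : KBool κ := free κ X

/-- The generators of the free algebra. -/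
def freeAlgebra.of (κ : Cardinal.{u}) {X : Type u} (x : X) : freeAlgebra κ X := free.of κ x

/-- The homomorphism from a free algebra determined by the images of the generators. -/
noncomputable def freeAlgebra.lift (f : X → A) : freeAlgebra κ X ⟶ A := free.lift f

@[simp]
theorem freeAlgebra.lift_of (f : X → A) (x : X) :
    (freeAlgebra.lift f).hom (freeAlgebra.of κ x) = f x := rfl

theorem freeAlgebra.hom_ext {f g : freeAlgebra κ X ⟶ A}
    (h : ∀ x, f.hom (freeAlgebra.of κ x) = g.hom (freeAlgebra.of κ x)) : f = g := free.hom_ext h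

theorem freeAlgebra.lift_surjective_of_surjective {f : X → A} (hf : Function.Surjective f) :
    Function.Surjective (freeAlgebra.lift f).hom := fun a => by
  obtain ⟨x, rfl⟩ := hf a
  exact ⟨freeAlgebra.of κ x, rfl⟩

/-- `p` exhibits `A` as presented by the generators `X` and the relations `r`. -/
structure IsPresentation (r : Set (freeAlgebra κ X × freeAlgebra κ X))
    (p : freeAlgebra κ X ⟶ A) : Prop where
  surjective : Function.Surjective p.hom
  ker_iff : ∀ a b, p.hom a = p.hom b ↔ congruenceGen (freeAlgebra κ X) r a b

theorem exists_isPresentation (r : Set (freeAlgebra κ X × freeAlgebra κ X)) :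
    ∃ (A : KBool κ) (p : freeAlgebra κ X ⟶ A), IsPresentation r p :=
  let ⟨A, p, hp, h⟩ := exists_quotient (isCongruence_congruenceGen r)
  ⟨A, p, hp, h⟩

/-- The canonical presentation: all elements as generators and all valid relations. With no bound on
size, it lets one construction of colimits serve both arbitrary and `κ`-presented algebras. -/
theorem exists_isPresentation_of (A : KBool κ) :
    ∃ (X : Type u) (r : Set (freeAlgebra κ X × freeAlgebra κ X)) (p : freeAlgebra κ X ⟶ A),
      IsPresentation r p := by
  let p : freeAlgebra κ A ⟶ A := freeAlgebra.lift fun a : A => a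
  refine ⟨A, {x | p.hom x.1 = p.hom x.2}, p,
    freeAlgebra.lift_surjective_of_surjective Function.surjective_id,
    fun a b => ⟨fun h => ?_, fun h => ?_⟩⟩
  · exact congruenceGen_of_mem (p := (a, b)) h
  · exact h _ (isCongruence_ker p) fun _ hx => hx

namespace IsPresentation

variable {r : Set (freeAlgebra κ X × freeAlgebra κ X)} {p : freeAlgebra κ X ⟶ A}
  (hp : IsPresentation r p)

include hp

theorem epi : Epi p := epi_of_surjective p hp.surjective

theorem eq_of_mem {x : freeAlgebra κ X × freeAlgebra κ X} (hx : x ∈ r) : p.hom x.1 = p.hom x.2 :=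
  (hp.ker_iff _ _).2 (congruenceGen_of_mem hx)

theorem exists_desc (f : freeAlgebra κ X ⟶ B) (h : ∀ x ∈ r, f.hom x.1 = f.hom x.2) :
    ∃ g : A ⟶ B, p ≫ g = f :=
  exists_desc_of_surjective p hp.surjective f fun a b hab =>
    (hp.ker_iff a b).1 hab _ (isCongruence_ker f) h

theorem hom_ext {f g : A ⟶ B}
    (h : ∀ x, f.hom (p.hom (freeAlgebra.of κ x)) = g.hom (p.hom (freeAlgebra.of κ x))) : f = g := by
  have := hp.epi
  rw [← cancel_epi p]
  exact freeAlgebra.hom_ext h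

end IsPresentation

end Free

/-! ### Colimits -/

section Colimits

variable {J : Type u} [SmallCategory J]

/-- The colimit of a diagram of presented algebras is presented by the disjoint union of the
generators, subject to the given relations and one relation for every arrow of the diagram and every
generator of its source. -/
theorem exists_isColimit (F : J ⥤ KBool κ) {X : J → Type u}
    {r : ∀ j, Set (freeAlgebra κ (X j) × freeAlgebra κ (X j))}
    {p : ∀ j, freeAlgebra κ (X j) ⟶ F.obj j}
    (hp : ∀ j, IsPresentation (r j) (p j)) :
    ∃ (c : Cocone F)
      (g : (Σ j, r j) ⊕ (Σ φ : Arrow J, X φ.left) →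
        freeAlgebra κ (Σ j, X j) × freeAlgebra κ (Σ j, X j))
      (q : freeAlgebra κ (Σ j, X j) ⟶ c.pt),
      Nonempty (IsColimit c) ∧ IsPresentation (Set.range g) q := by
  -- `t φ x` is an element of the free algebra over the target of `φ` that represents the image of
  -- the generator `x`.
  choose t ht using fun (φ : Arrow J) (x : X φ.left) =>
    (hp φ.right).surjective ((F.map φ.hom).hom ((p φ.left).hom (freeAlgebra.of κ x)))
  let incl (j : J) : freeAlgebra κ (X j) ⟶ freeAlgebra κ (Σ j, X j) :=
    freeAlgebra.lift fun x => freeAlgebra.of κ ⟨j, x⟩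
  let g : (Σ j, r j) ⊕ (Σ φ : Arrow J, X φ.left) →
      freeAlgebra κ (Σ j, X j) × freeAlgebra κ (Σ j, X j) :=
    Sum.elim (fun x => ((incl x.1).hom x.2.1.1, (incl x.1).hom x.2.1.2))
      fun x => (freeAlgebra.of κ ⟨x.1.left, x.2⟩, (incl x.1.right).hom (t x.1 x.2))
  obtain ⟨Q, q, hq⟩ := exists_isPresentation (Set.range g)
  choose ι hι using fun j => (hp j).exists_desc (incl j ≫ q) fun x hx =>
    hq.eq_of_mem ⟨.inl ⟨j, x, hx⟩, rfl⟩
  let c : Cocone F :=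
    { pt := Q
      ι :=
        { app := ι
          -- On generators, naturality is exactly the relation attached to the arrow `φ`.
          naturality := fun j k φ => by
            refine (hp j).hom_ext fun x => ?_
            have h1 := hq.eq_of_mem ⟨.inr ⟨Arrow.mk φ, x⟩, rfl⟩
            have h2 := hom_congr (hι k) (t (Arrow.mk φ) x)
            have h3 := hom_congr (hι j) (freeAlgebra.of κ x)
            have h4 := ht (Arrow.mk φ) x
            exact (congrArg (ι k).hom h4.symm).trans (h2.trans (h1.symm.trans h3.symm)) } }
  have hdesc (s : Cocone F) (j : J) :
      incl j ≫ freeAlgebra.lift (fun x : Σ j, X j =>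
        (s.ι.app x.1).hom ((p x.1).hom (freeAlgebra.of κ x.2))) =
        p j ≫ s.ι.app j :=
    freeAlgebra.hom_ext fun x => rfl
  choose d hd using fun s : Cocone F =>
    hq.exists_desc (freeAlgebra.lift fun x =>
      (s.ι.app x.1).hom ((p x.1).hom (freeAlgebra.of κ x.2))) (by
      rintro _ ⟨x | ⟨φ, x⟩, rfl⟩
      · refine (hom_congr (hdesc s x.1) _).trans (Eq.trans ?_ (hom_congr (hdesc s x.1) _).symm)
        exact congrArg (s.ι.app x.1).hom ((hp x.1).eq_of_mem x.2.2)
      · refine Eq.trans ?_ (hom_congr (hdesc s φ.right) _).symm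
        refine Eq.trans ?_ (congrArg (s.ι.app φ.right).hom (ht φ x)).symm
        exact (hom_congr (s.w φ.hom) _).symm)
  refine ⟨c, g, q, ⟨{ desc := d, fac := fun s j => ?_, uniq := fun s m hm => ?_ }⟩, hq⟩
  · have := (hp j).epi
    rw [← cancel_epi (p j), reassoc_of% hι j, hd]
    exact hdesc s j
  · have := hq.epi
    rw [← cancel_epi q, hd]
    refine freeAlgebra.hom_ext fun x => ?_
    rw [freeAlgebra.lift_of, ← hm]
    exact congrArg m.hom (hom_congr (hι x.1) (freeAlgebra.of κ x.2)).symm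

instance hasColimitsOfSize : HasColimitsOfSize.{u, u} (KBool κ) where
  has_colimits_of_shape J _ := ⟨fun F => by
    choose X r p hp using fun j => exists_isPresentation_of (F.obj j)
    obtain ⟨c, -, -, ⟨hc⟩, -⟩ := exists_isColimit F hp
    exact ⟨⟨c, hc⟩⟩⟩

instance hasFiniteColimits : HasFiniteColimits (KBool κ) :=
  hasFiniteColimits_of_hasColimitsOfSize _

end Colimits

/-! ### Interpolation -/

section Forcing

variable {A B C : KBool κ}

/-- A map preserving complements and binary meets is a homomorphism as soon as it is compatible
with chosen joins. -/
theorem exists_hom_of_compl_of_inf (φ : A → B) (hcompl : ∀ a, φ aᶜ = (φ a)ᶜ)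
    (hinf : ∀ a b, φ (a ⊓ b) = φ a ⊓ φ b)
    (hsup : ∀ (I : Type u) (hI : HasCardinalLT I κ) (a : I → A) (t : B),
      (∀ i, t ≤ φ (a i)ᶜ) → t ≤ φ (kSup hI a)ᶜ) :
    ∃ f : A ⟶ B, ∀ a, f.hom a = φ a := by
  have hbot : φ ⊥ = ⊥ := by rw [← inf_compl_self (a := (⊥ : A)), hinf, hcompl, inf_compl_self]
  refine ⟨Hom.ofKSup
    { toFun := φ
      map_sup' := fun a b => by
        rw [← compl_inj_iff, compl_sup, ← hcompl, ← hcompl, ← hcompl, compl_sup, hinf]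
      map_inf' := hinf
      map_top' := by rw [← compl_bot, hcompl, hbot, compl_bot]
      map_bot' := hbot } fun I hI a t ht => ?_, fun a => rfl⟩
  have h1 := hsup I hI a tᶜ fun i => by
    rw [hcompl]
    exact compl_le_compl (ht i)
  rw [hcompl] at h1
  exact compl_le_compl_iff_le.1 h1

/-- The complete Boolean algebra of regular lower sets of a preorder. -/
abbrev regularLowerSet (κ : Cardinal.{u}) (P : Type u) [Preorder P] : KBool κ where
  carrier := Heyting.Regular (LowerSet P)
  hasKJoins s _ := by
    refine ⟨Heyting.Regular.toRegular (sSup ((↑) '' s)), ?_⟩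
    have h := Heyting.Regular.gi.gc.isLUB_l_image (isLUB_sSup (((↑) : _ → LowerSet P) '' s))
    rw [Set.image_image] at h
    simpa using h

/-- The forcing clause for negation: `x` is in `Uᶜ` when the lower set generated by `x` misses `U`.
-/
theorem mem_compl_lowerSet {P : Type u} [Preorder P] {U : LowerSet P} {x : P} :
    x ∈ Uᶜ ↔ ∀ y ≤ x, y ∉ U := by
  rw [← LowerSet.Iic_le, le_compl_iff_disjoint_right, disjoint_iff_inf_le]
  refine ⟨fun h y hy hU => (h (show y ∈ LowerSet.Iic x ⊓ U from ⟨hy, hU⟩)).elim,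
    fun h y hy => (h y hy.1 hy.2).elim⟩

/-- A homomorphism to an algebra of regular lower sets, from a relation `N x a` expressing that the
condition `x` forces `a` to be false. -/
theorem exists_hom_regularLowerSet {P : Type u} [Preorder P] (N : P → A → Prop)
    (hle : ∀ x y a, y ≤ x → N x a → N y a) (hmono : ∀ x a b, a ≤ b → N x b → N x a)
    (hsup : ∀ x a b, N x a → N x b → N x (a ⊔ b))
    (hkSup : ∀ (x) (I : Type u) (hI : HasCardinalLT I κ) (a : I → A),
      (∀ i, N x (a i)) → N x (kSup hI a))
    (htop : ∀ x, ¬ N x ⊤) (hcompl : ∀ x a, ¬ N x a → ∃ y ≤ x, N y aᶜ) :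
    ∃ f : A ⟶ regularLowerSet κ P, ∀ a x, x ∈ (f.hom a : LowerSet P) ↔ N x aᶜ := by
  let U (a : A) : LowerSet P := ⟨{x | N x a}, fun x y h => hle x y a h⟩
  -- If nothing below `x` refutes `a`, density (`hcompl`) makes `x` refute `aᶜ`. Conversely, a
  -- condition refuting both `a` and `aᶜ` would refute `⊤`.
  have hU (a : A) : (U a)ᶜ = U aᶜ := by
    ext x
    change x ∈ (U a)ᶜ ↔ _
    rw [mem_compl_lowerSet]
    refine ⟨fun h => ?_, fun h y hy hya => htop y ?_⟩
    · by_contra h1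
      obtain ⟨y, hy, h2⟩ := hcompl x aᶜ h1
      exact h y hy (by rwa [compl_compl] at h2)
    · rw [← sup_compl_eq_top (x := a)]
      exact hsup _ _ _ hya (hle _ _ _ hy h)
  let φ (a : A) : regularLowerSet κ P :=
    ⟨U aᶜ, by rw [Heyting.IsRegular, hU, hU, compl_compl]⟩
  obtain ⟨f, hf⟩ := exists_hom_of_compl_of_inf φ
    (fun a => Heyting.Regular.coe_injective (hU aᶜ).symm)
    (fun a b => Heyting.Regular.coe_injective <| by
      ext x
      change N x (a ⊓ b)ᶜ ↔ N x aᶜ ∧ N x bᶜ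
      rw [compl_inf]
      exact ⟨fun h => ⟨hmono _ _ _ le_sup_left h, hmono _ _ _ le_sup_right h⟩,
        fun h => hsup _ _ _ h.1 h.2⟩)
    (fun I hI a t ht x hx => by
      have h1 : N x (kSup hI a) := hkSup x I hI a fun i => by
        have h2 : N x (a i)ᶜᶜ := ht i hx
        rwa [compl_compl] at h2
      change N x (kSup hI a)ᶜᶜ
      rwa [compl_compl])
  refine ⟨f, fun a x => ?_⟩
  rw [hf]
  rfl

/-- `c` separates `a` from `b`. -/
def Separated (f : C ⟶ A) (g : C ⟶ B) (a : A) (b : B) : Prop :=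
  ∃ c : C, a ≤ f.hom c ∧ b ≤ (g.hom c)ᶜ

namespace Separated

variable {f : C ⟶ A} {g : C ⟶ B}

theorem mono {a a' : A} {b b' : B} (h : Separated f g a b) (ha : a' ≤ a) (hb : b' ≤ b) :
    Separated f g a' b' :=
  let ⟨c, h1, h2⟩ := h
  ⟨c, ha.trans h1, hb.trans h2⟩

theorem symm {a : A} {b : B} (h : Separated f g a b) : Separated g f b a := by
  obtain ⟨c, h1, h2⟩ := h
  exact ⟨cᶜ, by rwa [hom_compl], by rwa [hom_compl, compl_compl]⟩

theorem bot_left (b : B) : Separated f g ⊥ b := ⟨⊥, bot_le, by simp⟩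

theorem sup_left {a a' : A} {b : B} (h : Separated f g a b) (h' : Separated f g a' b) :
    Separated f g (a ⊔ a') b := by
  obtain ⟨c, h1, h2⟩ := h
  obtain ⟨c', h1', h2'⟩ := h'
  refine ⟨c ⊔ c', ?_, ?_⟩
  · rw [hom_sup]
    exact sup_le_sup h1 h1'
  · rw [hom_sup, compl_sup]
    exact le_inf h2 h2'

/-- The join of the separators separates. The factor `p` is the first component of a condition in
`exists_hom`. -/
theorem kSup_left {I : Type u} (hI : HasCardinalLT I κ) {a : I → A} {p : A} {b : B}
    (h : ∀ i, Separated f g (p ⊓ a i) b) : Separated f g (p ⊓ kSup hI a) b := by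
  choose c h1 h2 using h
  refine ⟨kSup hI c, ?_, ?_⟩
  · rw [inf_comm, kSup_inf_le_iff, map_kSup]
    intro i
    rw [inf_comm]
    exact (h1 i).trans (le_kSup hI (fun i => f.hom (c i)) i)
  · rw [le_compl_comm, map_kSup, kSup_le_iff]
    exact fun i => le_compl_comm.1 (h2 i)

/-- An element of `C` can be moved across: replace the separator `d` by `d ⊔ c` in one direction and
by `d ⊓ cᶜ` in the other. This makes the amalgamation square commute. -/
theorem inf_left_iff {a : A} {b : B} (c : C) :
    Separated f g (a ⊓ (f.hom c)ᶜ) b ↔ Separated f g a (b ⊓ (g.hom c)ᶜ) := by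
  constructor
  · rintro ⟨d, h1, h2⟩
    refine ⟨d ⊔ c, ?_, ?_⟩
    · rw [hom_sup]
      rwa [← sdiff_eq, sdiff_le_iff, sup_comm] at h1
    · rw [hom_sup, compl_sup]
      exact inf_le_inf_right _ h2
  · rintro ⟨d, h1, h2⟩
    refine ⟨d ⊓ cᶜ, ?_, ?_⟩
    · rw [hom_inf, hom_compl]
      exact inf_le_inf_right _ h1
    · rw [hom_inf, hom_compl, compl_inf, compl_compl]
      rwa [← sdiff_eq, sdiff_le_iff, sup_comm] at h2

/-- Conditions that determine a pair of non-separated elements, and whose first component can be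
shrunk, induce a homomorphism on the first algebra. -/
theorem exists_hom (f : C ⟶ A) (g : C ⟶ B) {P : Type u} [Preorder P] (s : P → A) (t : P → B)
    (hs : Monotone s) (ht : Monotone t) (hst : ∀ x, ¬ Separated f g (s x) (t x))
    (hP : ∀ x a, ¬ Separated f g (s x ⊓ a) (t x) → ∃ y ≤ x, s y = s x ⊓ a) :
    ∃ i : A ⟶ regularLowerSet κ P,
      ∀ a x, x ∈ (i.hom a : LowerSet P) ↔ Separated f g (s x ⊓ aᶜ) (t x) := by
  refine exists_hom_regularLowerSet (fun x a => Separated f g (s x ⊓ a) (t x))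
    (fun x y a h h1 => h1.mono (inf_le_inf_right _ (hs h)) (ht h))
    (fun x a b h h1 => h1.mono (inf_le_inf_left _ h) le_rfl)
    (fun x a b h1 h2 => by rw [inf_sup_left]; exact h1.sup_left h2)
    (fun x I hI a h => kSup_left hI h) (fun x => by rw [inf_top_eq]; exact hst x)
    (fun x a h => ?_)
  obtain ⟨y, hy, h1⟩ := hP x a h
  refine ⟨y, hy, ?_⟩
  rw [h1, inf_assoc, inf_compl_self, inf_bot_eq]
  exact bot_left _

end Separated

/-- If `a` and `b` are not separated by an element of `C`, then some amalgam of `A` and `B` over `C`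
identifies `a` and `b` with elements that are not disjoint. -/
theorem exists_amalgam (f : C ⟶ A) (g : C ⟶ B) (a : A) (b : B) (hab : ¬ Separated f g a b) :
    ∃ (D : KBool κ) (i : A ⟶ D) (j : B ⟶ D), f ≫ i = g ≫ j ∧ i.hom a ⊓ j.hom b ≠ ⊥ := by
  -- The conditions are the non-separated pairs, ordered componentwise; `x` forces `a` when `x.1 ⊓
  -- aᶜ` is separated from `x.2`, and symmetrically for `b`.
  let P : Type u := {x : A × B // ¬ Separated f g x.1 x.2}
  have hP (x y : P) : x ≤ y ↔ x.1.1 ≤ y.1.1 ∧ x.1.2 ≤ y.1.2 := Iff.rfl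
  obtain ⟨i, hi⟩ := Separated.exists_hom f g (fun x : P => x.1.1) (fun x => x.1.2)
    (fun x y h => ((hP x y).1 h).1) (fun x y h => ((hP x y).1 h).2) (fun x => x.2)
    fun x a h => ⟨⟨(x.1.1 ⊓ a, x.1.2), h⟩, (hP _ _).2 ⟨inf_le_left, le_rfl⟩, rfl⟩
  obtain ⟨j, hj⟩ := Separated.exists_hom g f (fun x : P => x.1.2) (fun x => x.1.1)
    (fun x y h => ((hP x y).1 h).2) (fun x y h => ((hP x y).1 h).1) (fun x h => x.2 h.symm)
    fun x b h => ⟨⟨(x.1.1, x.1.2 ⊓ b), fun h1 => h h1.symm⟩,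
      (hP _ _).2 ⟨le_rfl, inf_le_left⟩, rfl⟩
  refine ⟨_, i, j, hom_ext fun c => Heyting.Regular.coe_injective ?_, fun h => ?_⟩
  · ext x
    refine (hi _ x).trans (Iff.trans ?_ (hj _ x).symm)
    exact (Separated.inf_left_iff c).trans ⟨Separated.symm, Separated.symm⟩
  · let x : P := ⟨(a, b), hab⟩
    have h1 : x ∈ (i.hom a : LowerSet P) := (hi a x).2 (by
      rw [inf_compl_self]; exact Separated.bot_left _)
    have h2 : x ∈ (j.hom b : LowerSet P) := (hj b x).2 (by
      rw [inf_compl_self]; exact Separated.bot_left _)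
    exact (congrArg (fun U : Heyting.Regular (LowerSet P) => x ∈ (U : LowerSet P)) h).mp ⟨h1, h2⟩

/-- An element `c` separates `a` from `aᶜ` only if `f c = a`. So for `a` outside the image some
amalgam has `i a ⊓ j aᶜ ≠ ⊥`, while `f ≫ i = f ≫ j` forces `i = j`. -/
theorem surjective_of_epi (f : C ⟶ A) [Epi f] : Function.Surjective f.hom := by
  intro a
  by_contra h
  obtain ⟨D, i, j, hij, hne⟩ := exists_amalgam f f a aᶜ (by
    rintro ⟨c, h1, h2⟩
    exact h ⟨c, le_antisymm (compl_le_compl_iff_le.1 h2) h1⟩)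
  rw [cancel_epi] at hij
  rw [hij, ← hom_inf, inf_compl_self, hom_bot] at hne
  exact hne rfl

end Forcing

/-! ### Principal quotients -/

section Principal

variable {A B C D : KBool κ}

/-- `π` exhibits `B` as the quotient of `A` by the congruence generated by the pair `(e, ⊤)`. -/
structure IsPrincipal (π : A ⟶ B) (e : A) : Prop where
  surjective : Function.Surjective π.hom
  eq_iff : ∀ a b, π.hom a = π.hom b ↔ a ⊓ e = b ⊓ e

theorem exists_isPrincipal (e : A) : ∃ (B : KBool κ) (π : A ⟶ B), IsPrincipal π e :=
  let ⟨B, π, h1, h2⟩ := exists_quotient (isCongruence_inf e)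
  ⟨B, π, h1, h2⟩

theorem inf_eq_inf_of_map {f : A ⟶ B} {e a b : A} (he : f.hom e = ⊤) (h : a ⊓ e = b ⊓ e) :
    f.hom a = f.hom b := by
  simpa [hom_inf, he] using congrArg f.hom h

namespace IsPrincipal

variable {π : A ⟶ B} {e : A} (h : IsPrincipal π e)

include h

theorem eq_top_iff (a : A) : π.hom a = ⊤ ↔ e ≤ a := by
  rw [← hom_top π, h.eq_iff, top_inf_eq, inf_eq_right]

theorem map_self : π.hom e = ⊤ := (h.eq_top_iff e).2 le_rfl

theorem epi : Epi π := epi_of_surjective π h.surjective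

/-- The generator is the least element sent to `⊤`. -/
theorem unique {e' : A} (h' : IsPrincipal π e') : e = e' :=
  le_antisymm ((h.eq_top_iff e').1 h'.map_self) ((h'.eq_top_iff e).1 h.map_self)

theorem exists_desc (f : A ⟶ C) (hf : f.hom e = ⊤) : ∃ g : B ⟶ C, π ≫ g = f :=
  exists_desc_of_surjective π h.surjective f fun a b hab =>
    inf_eq_inf_of_map hf ((h.eq_iff a b).1 hab)

theorem of_iso_comp {f : D ⟶ A} [IsIso f] {d : D} (hd : f.hom d = e) : IsPrincipal (f ≫ π) d where
  surjective := h.surjective.comp (bijective_of_isIso f).2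
  eq_iff a b := by
    rw [comp_hom_apply, comp_hom_apply, h.eq_iff, ← hd, ← hom_inf, ← hom_inf,
      (bijective_of_isIso f).1.eq_iff]

theorem comp_iso (f : B ⟶ C) [IsIso f] : IsPrincipal (π ≫ f) e where
  surjective := (bijective_of_isIso f).2.comp h.surjective
  eq_iff a b := by
    rw [comp_hom_apply, comp_hom_apply, (bijective_of_isIso f).1.eq_iff, h.eq_iff]

theorem comp {π' : B ⟶ C} {e' : A} (h' : IsPrincipal π' (π.hom e')) :
    IsPrincipal (π ≫ π') (e' ⊓ e) where
  surjective := h'.surjective.comp h.surjective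
  eq_iff a b := by
    rw [comp_hom_apply, comp_hom_apply, h'.eq_iff, ← hom_inf, ← hom_inf, h.eq_iff, inf_assoc,
      inf_assoc]

/-- Principal quotients are stable under pushout. -/
theorem of_isPushout {f : A ⟶ C} {p : C ⟶ D} {g : B ⟶ D} (sq : IsPushout f π p g) :
    IsPrincipal p (f.hom e) := by
  obtain ⟨Q, q, hq⟩ := exists_isPrincipal (f.hom e)
  obtain ⟨k, hk⟩ := h.exists_desc (f ≫ q) hq.map_self
  have hp : p.hom (f.hom e) = ⊤ := by
    refine (hom_congr sq.w e).trans ?_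
    rw [comp_hom_apply, h.map_self, hom_top]
  obtain ⟨l, hl⟩ := hq.exists_desc p hp
  -- The pushout `D` is compared with the quotient `Q` of `C` at `f e`: the map `D ⟶ Q` is split by
  -- `l`, so `p` identifies no more than `q` does.
  have h1 : sq.desc q k hk.symm ≫ l = 𝟙 D := by
    have := h.epi
    apply sq.hom_ext
    · simp [hl]
    · rw [← cancel_epi π]
      simp [reassoc_of% hk, hl, sq.w]
  refine ⟨fun d => ?_, fun a b => ⟨fun hab => ?_, inf_eq_inf_of_map hp⟩⟩
  · obtain ⟨c, hc⟩ := hq.surjective ((sq.desc q k hk.symm).hom d)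
    refine ⟨c, ?_⟩
    rw [← hl, comp_hom_apply, hc]
    exact hom_congr h1 d
  · rw [← hq.eq_iff, ← sq.inl_desc q k hk.symm, comp_hom_apply, hab, comp_hom_apply]

end IsPrincipal

/-- A principal quotient factors through another one if and only if its kernel is larger. -/
theorem IsPrincipal.exists_comp_eq_iff {π : A ⟶ B} {e : A} (h : IsPrincipal π e) {π' : A ⟶ C}
    {e' : A} (h' : IsPrincipal π' e') : (∃ g : C ⟶ B, π' ≫ g = π) ↔ e ≤ e' := by
  constructor
  · rintro ⟨g, rfl⟩
    rw [← h.eq_top_iff, comp_hom_apply, h'.map_self, hom_top]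
  · exact fun hle => h'.exists_desc π ((h.eq_top_iff _).2 hle)

end Principal

/-! ### Products -/

section Product

variable {I : Type u}

/-- The product of a family of `κ`-complete Boolean algebras. -/
abbrev pi (A : I → KBool κ) : KBool κ where
  carrier := ∀ i, A i
  hasKJoins s hs := by
    refine ⟨fun i => kSup hs fun x => x.1 i, isLUB_pi.2 fun i => ?_⟩
    rw [Set.image_eq_range]
    exact isLUB_kSup hs fun x => x.1 i

/-- The projections of a product. -/
def pi.proj (A : I → KBool κ) (i : I) : pi A ⟶ A i where
  hom :=
    { toFun := fun a => a i
      map_sup' := fun _ _ => rfl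
      map_inf' := fun _ _ => rfl
      map_top' := rfl
      map_bot' := rfl }
  map_isLUB _ _ _ h := isLUB_pi.1 h i

/-- The homomorphism to a product with given components. -/
def pi.lift {A : I → KBool κ} {B : KBool κ} (f : ∀ i, B ⟶ A i) : B ⟶ pi A where
  hom :=
    { toFun := fun b i => (f i).hom b
      map_sup' := fun _ _ => funext fun i => hom_sup (f i) _ _
      map_inf' := fun _ _ => funext fun i => hom_inf (f i) _ _
      map_top' := funext fun i => hom_top (f i)
      map_bot' := funext fun i => hom_bot (f i) }
  map_isLUB s a hs h := isLUB_pi.2 fun i => by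
    rw [Set.image_image]
    exact (f i).map_isLUB s a hs h

/-- The product fan. -/
def piFan (A : I → KBool κ) : Fan A := Fan.mk (pi A) (pi.proj A)

/-- The product fan is a limit. -/
def piFanIsLimit (A : I → KBool κ) : IsLimit (piFan A) :=
  Fan.IsLimit.mk _ (fun s => pi.lift s.proj) (fun _ _ => rfl)
    fun _ _ hm => hom_ext fun b => funext fun i => hom_congr (hm i) b

instance hasProduct (A : I → KBool κ) : HasProduct A := ⟨⟨_, piFanIsLimit A⟩⟩

instance hasProductsOfShape (I : Type u) : HasProductsOfShape I (KBool κ) :=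
  ⟨fun _ => hasLimit_of_iso Discrete.natIsoFunctor.symm⟩

/-- A family of principal quotients whose kernels form a partition of unity is a product. -/
theorem nonempty_isLimit_of_isPrincipal (hI : HasCardinalLT I κ) {A : I → KBool κ} {B : KBool κ}
    {π : ∀ i, B ⟶ A i} {e : I → B} (h : ∀ i, IsPrincipal (π i) (e i))
    (hdisj : ∀ i j, i ≠ j → e i ⊓ e j = ⊥) (htop : kSup hI e = ⊤) :
    Nonempty (IsLimit (Fan.mk B π)) := by
  have : IsIso (pi.lift π) := isIso_of_bijective _ (by
    refine ⟨fun a b hab => ?_, fun a => ?_⟩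
    · have h1 (i : I) : a ⊓ e i = b ⊓ e i := ((h i).eq_iff a b).1 (congrFun hab i)
      -- Each element is the join of its pieces under the partition of unity.
      have h2 (c : B) : c = kSup hI fun i => c ⊓ e i := by
        refine le_antisymm ?_ ((kSup_le_iff hI).2 fun i => inf_le_left)
        have : kSup hI e ⊓ c ≤ kSup hI fun i => c ⊓ e i := (kSup_inf_le_iff hI).2 fun i => by
          rw [inf_comm]
          exact le_kSup hI (fun i => c ⊓ e i) i
        rwa [htop, top_inf_eq] at this
      rw [h2 a, h2 b, kSup_congr hI h1]
    · choose b hb using fun i => (h i).surjective (a i)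
      -- Glue: use the lift `b i` on the piece `e i`.
      refine ⟨kSup hI fun i => b i ⊓ e i, funext fun j => ?_⟩
      change (π j).hom _ = _
      rw [← hb j, (h j).eq_iff]
      refine le_antisymm ((kSup_inf_le_iff hI).2 fun i => ?_) ?_
      · by_cases hij : i = j
        · subst hij
          exact inf_le_inf_right _ inf_le_left
        · rw [inf_assoc, hdisj i j hij, inf_bot_eq]
          exact bot_le
      · exact le_inf (le_kSup hI (fun i => b i ⊓ e i) j) inf_le_right)
  exact ⟨(piFanIsLimit A).ofIsoLimit (Fan.ext (asIso (pi.lift π)).symm fun i =>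
    ((asIso (pi.lift π)).eq_inv_comp).2 rfl)⟩

/-- The projections of a product are principal quotients whose kernels form a partition of unity. -/
theorem exists_isPrincipal_of_isLimit (hI : HasCardinalLT I κ) {A : I → KBool κ} {c : Fan A}
    (hc : IsLimit c) :
    ∃ e : I → c.pt, (∀ i, IsPrincipal (c.proj i) (e i)) ∧ (∀ i j, i ≠ j → e i ⊓ e j = ⊥) ∧
      kSup hI e = ⊤ := by
  classical
  let φ : c ≅ piFan A := hc.uniqueUpToIso (piFanIsLimit A)
  let ψ : c.pt ⟶ pi A := φ.hom.hom
  have hψ : IsIso ψ := ((Cone.forget _).mapIso φ).isIso_hom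
  have hψ' (i : I) : c.proj i = ψ ≫ pi.proj A i := (φ.hom.w ⟨i⟩).symm
  -- Indicator elements of the coordinates, transported to `c.pt` along the isomorphism `ψ`.
  let δ (i : I) : pi A := fun j => if i = j then ⊤ else ⊥
  have hδ (i : I) : IsPrincipal (pi.proj A i) (δ i) := by
    refine ⟨fun a => ⟨Function.update (⊥ : ∀ i, A i) i a,
      show Function.update (⊥ : ∀ i, A i) i a i = a from Function.update_self ..⟩,
      fun a b => ⟨fun h => ?_, inf_eq_inf_of_map (if_pos rfl)⟩⟩
    funext j
    change a j ⊓ (if i = j then ⊤ else ⊥) = b j ⊓ (if i = j then ⊤ else ⊥)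
    split_ifs with hij
    · subst hij
      rw [show a i = b i from h]
    · rw [inf_bot_eq, inf_bot_eq]
  choose e he using fun i => (bijective_of_isIso ψ).2 (δ i)
  refine ⟨e, fun i => ?_, fun i j hij => ?_, ?_⟩
  · rw [hψ']
    exact (hδ i).of_iso_comp (he i)
  · apply (bijective_of_isIso ψ).1
    rw [hom_inf, he, he, hom_bot]
    funext k
    change (if i = k then ⊤ else ⊥) ⊓ (if j = k then ⊤ else ⊥) = (⊥ : A k)
    split_ifs with h1 h2
    · exact (hij (h1.trans h2.symm)).elim
    all_goals simp
  · apply (bijective_of_isIso ψ).1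
    rw [map_kSup, hom_top, eq_top_iff]
    intro k
    have := le_kSup hI (fun i => ψ.hom (e i)) k k
    rw [he] at this
    exact (if_pos rfl).ge.trans this

end Product

/-! ### Presented algebras -/

section Presented

variable {A B : KBool κ}

theorem IsPresentation.isPrincipal {X I : Type u} (hI : HasCardinalLT I κ)
    {g : I → freeAlgebra κ X × freeAlgebra κ X} {p : freeAlgebra κ X ⟶ A}
    (hp : IsPresentation (Set.range g) p) :
    IsPrincipal p (kInf hI fun i => (g i).1 ⇔ (g i).2) :=
  ⟨hp.surjective, fun a b => (hp.ker_iff a b).trans (congruenceGen_iff hI g a b)⟩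

/-- An algebra is `κ`-presented if and only if it is a principal quotient of a free algebra on fewer
than `κ` generators. -/
theorem isKPresented_iff (hκ : κ.IsRegular) : IsKPresented κ A ↔
    ∃ (X : Type u) (_ : HasCardinalLT X κ) (e : freeAlgebra κ X) (p : freeAlgebra κ X ⟶ A),
      IsPrincipal p e := by
  constructor
  · rintro ⟨X, (r : Set (freeAlgebra κ X × freeAlgebra κ X)), (p : freeAlgebra κ X ⟶ A), hX, hr, hp,
      h⟩
    have hp' : IsPresentation (Set.range ((↑) : r → freeAlgebra κ X × freeAlgebra κ X)) p :=
      ⟨hp, by rwa [Subtype.range_coe]⟩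
    exact ⟨X, hX, _, p, hp'.isPrincipal hr⟩
  · rintro ⟨X, hX, e, p, hp⟩
    have h1 : HasCardinalLT PUnit.{u + 1} κ := hasCardinalLT_of_finite _ _ hκ.aleph0_le
    let g (_ : PUnit.{u + 1}) : freeAlgebra κ X × freeAlgebra κ X := (e, ⊤)
    have h2 : kInf h1 (fun i => (g i).1 ⇔ (g i).2) = e := by
      refine le_antisymm ((kInf_le h1 _ PUnit.unit).trans_eq (bihimp_top e))
        ((le_kInf_iff h1).2 fun i => (bihimp_top e).ge)
    refine ⟨X, Set.range g, p, hX, h1.of_surjective _ Set.rangeFactorization_surjective,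
      hp.surjective, fun a b => ?_⟩
    refine Iff.trans ?_ (congruenceGen_iff h1 g a b).symm
    rw [h2]
    exact hp.eq_iff a b

/-- Lift `e` to the free algebra and meet it with the generator of the first kernel. -/
theorem IsKPresented.of_isPrincipal (hκ : κ.IsRegular) (hA : IsKPresented κ A) {π : A ⟶ B} {e : A}
    (h : IsPrincipal π e) : IsKPresented κ B := by
  obtain ⟨X, hX, u, p, hp⟩ := (isKPresented_iff hκ).1 hA
  obtain ⟨e', rfl⟩ := hp.surjective e
  exact (isKPresented_iff hκ).2 ⟨X, hX, _, _, hp.comp h⟩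

theorem IsKPresented.of_iso (hκ : κ.IsRegular) (hA : IsKPresented κ A) (f : A ≅ B) :
    IsKPresented κ B := by
  obtain ⟨X, hX, u, p, hp⟩ := (isKPresented_iff hκ).1 hA
  exact (isKPresented_iff hκ).2 ⟨X, hX, _, _, hp.comp_iso f.hom⟩

/-- A surjection from a free algebra on fewer than `κ` generators to a `κ`-presented algebra is a
principal quotient. -/
theorem IsKPresented.exists_isPrincipal_of_free (hκ : κ.IsRegular) (hA : IsKPresented κ A)
    {X : Type u} (hX : HasCardinalLT X κ) (f : freeAlgebra κ X ⟶ A)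
    (hf : Function.Surjective f.hom) :
    ∃ e, IsPrincipal f e := by
  obtain ⟨Y, -, v, g, hg⟩ := (isKPresented_iff hκ).1 hA
  choose s hs using fun y : Y => hf (g.hom (freeAlgebra.of κ y))
  choose t ht using fun x : X => hg.surjective (f.hom (freeAlgebra.of κ x))
  let σ : freeAlgebra κ Y ⟶ freeAlgebra κ X := freeAlgebra.lift s
  let τ : freeAlgebra κ X ⟶ freeAlgebra κ Y := freeAlgebra.lift t
  have hσ : σ ≫ f = g := freeAlgebra.hom_ext hs
  have hτ : τ ≫ g = f := freeAlgebra.hom_ext ht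
  -- Change of generators: the kernel of `f` is generated by the relation `v` transported along `σ`,
  -- together with the relations `x = σ (t x)` that express the old generators through the new ones.
  let w := kInf hX fun x => freeAlgebra.of κ x ⇔ σ.hom (t x)
  have hw : f.hom w = ⊤ := by
    rw [map_kInf]
    refine kInf_eq_top hX fun x => ?_
    rw [map_bihimp, ← comp_hom_apply, hσ, ht, bihimp_self]
  have hfe : f.hom (σ.hom v ⊓ w) = ⊤ := by
    rw [hom_inf, hw, ← comp_hom_apply, hσ, hg.map_self, inf_top_eq]
  obtain ⟨Q, q, hq⟩ := exists_isPrincipal (σ.hom v ⊓ w)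
  have h1 : τ ≫ σ ≫ q = q := by
    refine freeAlgebra.hom_ext fun x => ?_
    change q.hom (σ.hom (t x)) = _
    have h2 : σ.hom v ⊓ w ≤ freeAlgebra.of κ x ⇔ σ.hom (t x) := inf_le_right.trans (kInf_le hX _ x)
    rw [hq.eq_iff, inf_eq_inf_of_le_bihimp h2]
  obtain ⟨k, hk⟩ := hg.exists_desc (σ ≫ q) (by
    refine (hq.eq_top_iff _).2 inf_le_left)
  refine ⟨σ.hom v ⊓ w, hf, fun a b => ⟨fun hab => ?_, inf_eq_inf_of_map hfe⟩⟩
  -- Since `q` factors through `f`, the kernel of `f` is contained in that of `q`.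
  have h2 : f ≫ k = q := by rw [← hτ, Category.assoc, hk, h1]
  rw [← hq.eq_iff, ← h2, comp_hom_apply, hab, comp_hom_apply]

/-- A surjection between `κ`-presented algebras is a principal quotient. -/
theorem IsKPresented.exists_isPrincipal (hκ : κ.IsRegular) (hA : IsKPresented κ A)
    (hB : IsKPresented κ B) (f : A ⟶ B) (hf : Function.Surjective f.hom) :
    ∃ e, IsPrincipal f e := by
  obtain ⟨X, hX, v, p, hp⟩ := (isKPresented_iff hκ).1 hA
  obtain ⟨e, he⟩ := hB.exists_isPrincipal_of_free hκ hX (p ≫ f) (hf.comp hp.surjective)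
  refine ⟨p.hom e, hf, fun a b => ⟨fun hab => ?_, inf_eq_inf_of_map he.map_self⟩⟩
  obtain ⟨a, rfl⟩ := hp.surjective a
  obtain ⟨b, rfl⟩ := hp.surjective b
  rw [← hom_inf, (he.eq_iff a b).1 hab, hom_inf]

/-- Besides the generators of the factors, one generator per index stands for the indicator of that
coordinate. It makes the kernel generators `v i` vanish in the other factors, so elements can be
glued and the free algebra maps onto the product. The kernel of this map is the intersection of the
kernels at the `v i`, which is the kernel at their join. -/
theorem isKPresented_pi (hκ : κ.IsRegular) {I : Type u} (hI : HasCardinalLT I κ) (A : I → KBool κ)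
    (hA : ∀ i, IsKPresented κ (A i)) : IsKPresented κ (pi A) := by
  classical
  have : Fact κ.IsRegular := ⟨hκ⟩
  choose X hX u p hp using fun i => (isKPresented_iff hκ).1 (hA i)
  let Y : Type u := I ⊕ Σ i, X i
  have hY : HasCardinalLT Y κ :=
    (hasCardinalLT_sum_iff _ _ _ hκ.aleph0_le).2 ⟨hI, hasCardinalLT_sigma' _ _ hI hX⟩
  -- The value `⊥` on the generators of the other factors is arbitrary; the values on the index
  -- generators are not.
  let q (i : I) : freeAlgebra κ Y ⟶ A i := freeAlgebra.lift (Sum.elim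
    (fun j => if j = i then ⊤ else ⊥)
    fun x => if h : x.1 = i then (p i).hom (freeAlgebra.of κ (h ▸ x.2)) else ⊥)
  have hq (i : I) : freeAlgebra.lift (fun x => freeAlgebra.of κ (.inr ⟨i, x⟩)) ≫ q i = p i :=
    freeAlgebra.hom_ext fun x => by
      change (if h : i = i then (p i).hom (freeAlgebra.of κ (h ▸ x)) else ⊥) = _
      simp
  have hqs (i : I) : Function.Surjective (q i).hom := fun a => by
    obtain ⟨b, rfl⟩ := (hp i).surjective a
    exact ⟨_, hom_congr (hq i) b⟩
  have hq1 (i : I) : (q i).hom (freeAlgebra.of κ (.inl i)) = ⊤ := if_pos rfl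
  have hq0 (i j : I) (h : i ≠ j) : (q j).hom (freeAlgebra.of κ (.inl i)) = ⊥ := if_neg h
  choose v hv using fun i => (hA i).exists_isPrincipal_of_free hκ hY (q i) (hqs i)
  -- The `i`-th index generator is `⊤` in `A i`, so it lies above `v i`, and it is `⊥` in `A j`.
  have hv0 (i j : I) (h : i ≠ j) : (q j).hom (v i) = ⊥ := by
    have h1 := ((hv i).eq_top_iff _).1 (hq1 i)
    exact le_bot_iff.1 ((OrderHomClass.mono (q j).hom h1).trans_eq (hq0 i j h))
  refine (isKPresented_iff hκ).2 ⟨Y, hY, kSup hI v, pi.lift q, fun a => ?_, fun a b => ?_⟩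
  · choose t ht using fun i => hqs i (a i)
    refine ⟨kSup hI fun i => t i ⊓ v i, funext fun j => ?_⟩
    change (q j).hom _ = a j
    rw [map_kSup]
    apply le_antisymm
    · refine (kSup_le_iff hI).2 fun i => ?_
      by_cases hij : i = j
      · subst hij
        rw [hom_inf, ht]
        exact inf_le_left
      · rw [hom_inf, hv0 i j hij, inf_bot_eq]
        exact bot_le
    · have := le_kSup hI (fun i => (q j).hom (t i ⊓ v i)) j
      rwa [hom_inf, ht, (hv j).map_self, inf_top_eq] at this
  · have h1 : (pi.lift q).hom a = (pi.lift q).hom b ↔ ∀ i, a ⊓ v i = b ⊓ v i :=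
      funext_iff.trans (forall_congr' fun i => (hv i).eq_iff a b)
    rw [h1]
    refine ⟨fun h => ?_, fun h i => ?_⟩
    · have key (x : freeAlgebra κ Y) := isLUB_inf (isLUB_kSup hI v) x
      have h2 (i : I) : v i ⊓ a = v i ⊓ b := by rw [inf_comm, h, inf_comm]
      rw [inf_comm, inf_comm b]
      refine (key a).unique ?_
      rw [funext h2]
      exact key b
    · rw [← inf_eq_right.2 (le_kSup hI v i), ← inf_assoc, h, inf_assoc]

/-- A colimit of a diagram with fewer than `κ` arrows of `κ`-presented algebras is `κ`-presented. -/
theorem isClosedUnderColimitsOfShape (hκ : κ.IsRegular) (J : Type u) [SmallCategory J]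
    (hJ : HasCardinalLT (Arrow J) κ) : (IsKPresented κ).IsClosedUnderColimitsOfShape J where
  colimitsOfShape_le := by
    rintro A ⟨h⟩
    have : Fact κ.IsRegular := ⟨hκ⟩
    have hJ' : HasCardinalLT J κ := hasCardinalLT_of_hasCardinalLT_arrow hJ
    choose X r p hX hr hp hk using h.prop_diag_obj
    obtain ⟨c, g, q, ⟨hc⟩, hq⟩ := exists_isColimit h.diag fun j => ⟨hp j, hk j⟩
    have h1 : HasCardinalLT ((Σ j, r j) ⊕ (Σ φ : Arrow J, X φ.left)) κ :=
      (hasCardinalLT_sum_iff _ _ _ hκ.aleph0_le).2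
        ⟨hasCardinalLT_sigma' _ _ hJ' hr, hasCardinalLT_sigma' _ _ hJ fun φ => hX φ.left⟩
    have h2 : IsKPresented κ c.pt :=
      (isKPresented_iff hκ).2 ⟨_, hasCardinalLT_sigma' _ _ hJ' hX, _, q, hq.isPrincipal h1⟩
    exact h2.of_iso hκ (hc.coconePointUniqueUpToIso h.isColimit)

/-- Lifting the shape to universe `u` leaves it finite, hence with fewer than `κ` arrows. -/
theorem isClosedUnderColimitsOfShape_of_finCategory (hκ : κ.IsRegular) (J : Type)
    [SmallCategory J] [FinCategory J] : (IsKPresented κ).IsClosedUnderColimitsOfShape J := by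
  have := isClosedUnderColimitsOfShape hκ (ULiftHom.{u} (ULift.{u} J))
    (hasCardinalLT_of_finite _ _ hκ.aleph0_le)
  exact .of_equivalence (ULiftHomULiftCategory.equiv J).symm

/-- A product of fewer than `κ` algebras that are `κ`-presented is `κ`-presented. -/
theorem isClosedUnderLimitsOfShape_discrete (hκ : κ.IsRegular) {I : Type u}
    (hI : HasCardinalLT I κ) : (IsKPresented κ).IsClosedUnderLimitsOfShape (Discrete I) where
  limitsOfShape_le := by
    rintro A ⟨h⟩
    refine (isKPresented_pi hκ hI _ fun i => h.prop_diag_obj ⟨i⟩).of_iso hκ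
      (IsLimit.conePointUniqueUpToIso (piFanIsLimit _)
        ((IsLimit.postcomposeHomEquiv (Discrete.natIsoFunctor) _).symm h.isLimit))
end Presented

/-! ### Extensivity -/

section Extensive

/-- The fan in `C` underlying a colimit cofan in the opposite category is a limit. -/
noncomputable def isLimitFanUnop {C : Type w} [Category.{v} C] {I : Type u} {X : I → Cᵒᵖ}
    {c : Cofan X} (hc : IsColimit c) :
    IsLimit (Fan.mk (f := fun i => (X i).unop) c.pt.unop fun i => (c.inj i).unop) :=
  Fan.IsLimit.mk _ (fun s => (Cofan.IsColimit.desc hc fun i => (s.proj i).op).unop)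
    (fun s i => Quiver.Hom.op_inj (Cofan.IsColimit.fac hc (fun i => (s.proj i).op) i))
    (fun s m hm => Quiver.Hom.op_inj (Cofan.IsColimit.hom_ext hc _ _ fun i => by
      refine Eq.trans ?_ (Cofan.IsColimit.fac hc (fun i => (s.proj i).op) i).symm
      exact Quiver.Hom.unop_inj (hm i)))

/-- The homomorphism to a trivial algebra. -/
def toSubsingleton (A B : KBool κ) [Subsingleton B] : A ⟶ B :=
  Hom.ofKSup
    { toFun := fun _ => ⊥
      map_sup' := fun _ _ => Subsingleton.elim _ _
      map_inf' := fun _ _ => Subsingleton.elim _ _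
      map_top' := Subsingleton.elim _ _
      map_bot' := Subsingleton.elim _ _ }
    fun _ _ _ _ _ => (Subsingleton.elim _ _).le

variable {C : Type w} [Category.{v} C] (G : C ⥤ KBool κ) [G.Full] [G.Faithful]

/-- Trivial algebras are terminal. -/
noncomputable def isTerminalOfSubsingleton (T : C) [Subsingleton (G.obj T)] : IsTerminal T :=
  IsTerminal.ofUniqueHom (fun A => G.preimage (toSubsingleton (G.obj A) (G.obj T)))
    fun _ _ => G.map_injective (hom_ext fun _ => Subsingleton.elim _ _)

theorem subsingleton_of_hom {A B : KBool κ} [Subsingleton A] (f : A ⟶ B) : Subsingleton B := by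
  refine subsingleton_of_bot_eq_top ?_
  rw [← hom_bot f, ← hom_top f, Subsingleton.elim ⊥ ⊤]

/-- A homomorphism preserves `⊥ = ⊤`, so only trivial algebras receive maps from a trivial one.
Dually, the initial object is strict. -/
theorem isIso_of_isTerminal {Z T B : C} [Subsingleton (G.obj Z)] (hT : IsTerminal T) (f : T ⟶ B) :
    IsIso f := by
  have := subsingleton_of_hom (G.map (hT.uniqueUpToIso (isTerminalOfSubsingleton G Z)).inv)
  have := subsingleton_of_hom (G.map f)
  have := isIso_of_bijective (G.map f)
    ⟨fun _ _ _ => Subsingleton.elim _ _, fun b => ⟨⊥, Subsingleton.elim _ _⟩⟩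
  exact isIso_of_reflects_iso f G

variable [HasFiniteColimits C] [PreservesColimitsOfShape WalkingSpan G]

/-- A full subcategory of the category of `κ`-complete Boolean algebras that is closed under
pushouts and under products of fewer than `κ` objects has a `κ`-extensive opposite. -/
theorem isKExtensive_op
    (hprod : ∀ I : Type u, HasCardinalLT I κ → HasProductsOfShape I C)
    (hpres : ∀ I : Type u, HasCardinalLT I κ → PreservesLimitsOfShape (Discrete I) G) :
    IsKExtensive κ Cᵒᵖ where
  hasFiniteLimits := inferInstance
  hasCoproduct I hI X := by
    have := hprod I hI
    infer_instance
  isPullbackStable I hI X c hc Y f P p q sq := by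
    have := hpres I hI
    obtain ⟨e, he, hdisj, htop⟩ := exists_isPrincipal_of_isLimit hI
      (isLimitFanMkObjOfIsLimit G _ _ (isLimitFanUnop hc))
    -- The pulled-back injections are the principal quotients at the images of the `e i`, again a
    -- partition of unity.
    have hp (i : I) : IsPrincipal (G.map (p i).unop) ((G.map f.unop).hom (e i)) :=
      (he i).of_isPushout ((sq i).unop.flip.map G)
    obtain ⟨h⟩ := nonempty_isLimit_of_isPrincipal hI hp
      (fun i j hij => by
        refine (hom_inf (G.map f.unop) (e i) (e j)).symm.trans ?_
        rw [hdisj i j hij]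
        exact hom_bot _)
      (by
        refine (map_kSup hI (G.map f.unop) e).symm.trans ?_
        rw [htop]
        exact hom_top _)
    exact ⟨Fan.IsLimit.op (isLimitOfIsLimitFanMkObj G (fun i => (P i).unop)
      (fun i => (p i).unop) h)⟩
  disjoint I hI X :=
    { nonempty_isInitial_of_ne := fun {c} hc {i j} hij s hs => by
        have := hpres I hI
        obtain ⟨e, he, hdisj, -⟩ := exists_isPrincipal_of_isLimit hI
          (isLimitFanMkObjOfIsLimit G _ _ (isLimitFanUnop hc))
        have h1 := (he i).of_isPushout ((IsPullback.of_isLimit hs).unop.map G)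
        -- The pushout of two distinct projections is the quotient at the image of `e i` in the
        -- `j`-th factor. That image is `⊥`, so `⊥ = ⊤` in the pushout.
        have h2 : (G.map (c.inj j).unop).hom (e i) = ⊥ := by
          refine Eq.trans (((he j).eq_iff _ _).2 ?_) (hom_bot (G.map (c.inj j).unop))
          rw [hdisj i j hij, bot_inf_eq]
        have h3 := h1.map_self
        have : Subsingleton (G.obj s.pt.unop) := subsingleton_of_bot_eq_top (by
          refine (hom_bot (G.map s.snd.unop)).symm.trans (Eq.trans ?_ h3)
          exact congrArg (G.map s.snd.unop).hom h2.symm)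
        exact ⟨initialOpOfTerminal (isTerminalOfSubsingleton G s.pt.unop)⟩
      mono_inj := fun {c} hc i => by
        have := hpres I hI
        obtain ⟨e, he, -, -⟩ := exists_isPrincipal_of_isLimit hI
          (isLimitFanMkObjOfIsLimit G _ _ (isLimitFanUnop hc))
        have : Epi (G.map (c.inj i).unop) := (he i).epi
        have : Epi (c.inj i).unop := G.epi_of_epi_map this
        exact inferInstanceAs (Mono (c.inj i).unop.op) }

end Extensive

/-! ### The category of presented algebras -/

section PresentedCategory

theorem hasFiniteColimits_presented (hκ : κ.IsRegular) : HasFiniteColimits (KBoolPresented κ) :=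
  ⟨fun J _ _ =>
    have := isClosedUnderColimitsOfShape_of_finCategory hκ J
    inferInstance⟩

theorem preservesColimitsOfShape_walkingSpan (hκ : κ.IsRegular) :
    PreservesColimitsOfShape WalkingSpan (IsKPresented κ).ι :=
  have := isClosedUnderColimitsOfShape_of_finCategory hκ WalkingSpan
  inferInstance

theorem hasProductsOfShape_presented (hκ : κ.IsRegular) {I : Type u} (hI : HasCardinalLT I κ) :
    HasProductsOfShape I (KBoolPresented κ) :=
  have := isClosedUnderLimitsOfShape_discrete hκ hI
  inferInstance

theorem preservesLimitsOfShape_discrete (hκ : κ.IsRegular) {I : Type u} (hI : HasCardinalLT I κ) :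
    PreservesLimitsOfShape (Discrete I) (IsKPresented κ).ι :=
  have := isClosedUnderLimitsOfShape_discrete hκ hI
  inferInstance

theorem isKComplete_presented_op (hκ : κ.IsRegular) : IsKComplete κ (KBoolPresented κ)ᵒᵖ := by
  intro J _ hJ
  have := isClosedUnderColimitsOfShape hκ Jᵒᵖ
    (hJ.of_surjective (fun φ : Arrow J => Arrow.mk φ.hom.op) fun φ => ⟨Arrow.mk φ.hom.unop, rfl⟩)
  exact hasLimitsOfShape_op_of_hasColimitsOfShape

/-- The empty product. -/
theorem exists_subsingleton_presented (hκ : κ.IsRegular) :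
    ∃ T : KBoolPresented κ, Subsingleton T.obj :=
  ⟨⟨pi (PEmpty.elim : PEmpty.{u + 1} → KBool κ), isKPresented_pi hκ
    (hasCardinalLT_of_finite _ _ hκ.aleph0_le) _ (fun i => i.elim)⟩,
    ⟨fun _ _ => funext fun i => i.elim⟩⟩

theorem hasStrictInitialObjects_presented_op (hκ : κ.IsRegular) :
    HasStrictInitialObjects (KBoolPresented κ)ᵒᵖ where
  out {I A} f hI := by
    obtain ⟨T, hT⟩ := exists_subsingleton_presented hκ
    have : Subsingleton ((IsKPresented κ).ι.obj T) := hT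
    have := isIso_of_isTerminal (IsKPresented κ).ι (Z := T) (terminalUnopOfInitial hI) f.unop
    exact inferInstanceAs (IsIso f.unop.op)

/-- The inclusion preserves pushouts, hence epimorphisms, so `f` is epi among all algebras and
therefore surjective. -/
theorem exists_isPrincipal_of_epi (hκ : κ.IsRegular) {A B : KBoolPresented κ} (f : A ⟶ B) [Epi f] :
    ∃ e, IsPrincipal ((IsKPresented κ).ι.map f) e := by
  have := preservesColimitsOfShape_walkingSpan hκ
  exact A.property.exists_isPrincipal hκ B.property _ (surjective_of_epi _)

/-! ### Subobjects in the opposite category as elements of the algebra -/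

variable (hκ : κ.IsRegular) {X Y : (KBoolPresented κ)ᵒᵖ}

/-- The element of a presented algebra generating the kernel of the quotient corresponding to a
subobject in the opposite category. -/
noncomputable def kernel (S : Subobject X) : X.unop.obj :=
  (exists_isPrincipal_of_epi hκ S.arrow.unop).choose

theorem isPrincipal_kernel (S : Subobject X) :
    IsPrincipal ((IsKPresented κ).ι.map S.arrow.unop) (kernel hκ S) :=
  (exists_isPrincipal_of_epi hκ S.arrow.unop).choose_spec

/-- Two reversals cancel: `S ≤ T` says that the quotient map of `S` factors through that of `T`, and
a larger quotient has a larger generator. -/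
theorem kernel_le_kernel {S T : Subobject X} : kernel hκ S ≤ kernel hκ T ↔ S ≤ T := by
  rw [← (isPrincipal_kernel hκ S).exists_comp_eq_iff (isPrincipal_kernel hκ T)]
  constructor
  · rintro ⟨g, hg⟩
    refine Subobject.le_of_comm ((IsKPresented κ).ι.preimage g).op (Quiver.Hom.unop_inj ?_)
    apply (IsKPresented κ).ι.map_injective
    rw [unop_comp, Functor.map_comp, Quiver.Hom.unop_op, Functor.map_preimage]
    exact hg
  · intro h
    refine ⟨(IsKPresented κ).ι.map (Subobject.ofLE S T h).unop, ?_⟩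
    rw [← Functor.map_comp, ← unop_comp, Subobject.ofLE_arrow]

/-- The quotient at `e` is again presented, and its projection is epi. -/
theorem kernel_surjective : Function.Surjective (kernel hκ (X := X)) := by
  intro e
  obtain ⟨B, π, hπ⟩ := exists_isPrincipal e
  let B' : KBoolPresented κ := ⟨B, X.unop.property.of_isPrincipal hκ hπ⟩
  let f : X.unop ⟶ B' := (IsKPresented κ).ι.preimage (X := X.unop) (Y := B') π
  have hf : (IsKPresented κ).ι.map f = π :=
    (IsKPresented κ).ι.map_preimage (X := X.unop) (Y := B') π
  have : Epi f := (IsKPresented κ).ι.epi_of_epi_map (hf ▸ hπ.epi)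
  refine ⟨Subobject.mk f.op, (isPrincipal_kernel hκ _).unique ?_⟩
  have h1 : (Subobject.mk f.op).arrow.unop = f ≫ (Subobject.underlyingIso f.op).hom.unop := by
    rw [← Subobject.underlyingIso_hom_comp_eq_mk, unop_comp]
    rfl
  rw [h1, Functor.map_comp, hf]
  exact hπ.comp_iso _

/-- Subobjects in the opposite of the category of presented algebras correspond to elements. -/
noncomputable def subobjectOrderIso (X : (KBoolPresented κ)ᵒᵖ) : Subobject X ≃o X.unop.obj :=
  RelIso.ofSurjective (OrderEmbedding.ofMapLEIff (kernel hκ) fun _ _ => kernel_le_kernel hκ)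
    (kernel_surjective hκ)

theorem isKBooleanPoset_subobject (hκ : κ.IsRegular) (X : (KBoolPresented κ)ᵒᵖ) :
    IsKBooleanPoset κ (Subobject X) := by
  let φ := subobjectOrderIso hκ X
  -- The one-point factor only raises the universe of the algebra to that of `Subobject X`.
  refine ⟨fun s hs => ?_, X.unop.obj × PUnit.{u + 2}, inferInstance, ⟨φ.trans ?_⟩⟩
  · obtain ⟨a, ha⟩ := X.unop.obj.hasKJoins (φ '' s)
      (hs.of_surjective _ Set.imageFactorization_surjective)
    exact ⟨φ.symm a, φ.isLUB_image.1 ha⟩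
  · exact
      { toFun := fun a => (a, PUnit.unit)
        invFun := fun a => a.1
        map_rel_iff' := by simp }

/-- A pullback of subobjects is a pushout of principal quotients, which moves the generator along
`f`. -/
theorem kernel_pullback [HasPullbacks (KBoolPresented κ)ᵒᵖ] (f : Y ⟶ X) (S : Subobject X) :
    kernel hκ ((Subobject.pullback f).obj S) =
      ((IsKPresented κ).ι.map f.unop).hom (kernel hκ S) := by
  have := preservesColimitsOfShape_walkingSpan hκ
  exact (isPrincipal_kernel hκ _).unique
    ((isPrincipal_kernel hκ S).of_isPushout ((Subobject.isPullback f S).unop.map _))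

theorem isKBooleanCategory_presented_op (hκ : κ.IsRegular) :
    IsKBooleanCategory κ (KBoolPresented κ)ᵒᵖ where
  isKSubextensive :=
    have := hasFiniteColimits_presented hκ
    { hasFiniteLimits := inferInstance
      hasInitial := by
        obtain ⟨T, hT⟩ := exists_subsingleton_presented hκ
        have : Subsingleton ((IsKPresented κ).ι.obj T) := hT
        exact (initialOpOfTerminal (isTerminalOfSubsingleton (IsKPresented κ).ι T)).hasInitial
      hasStrictInitialObjects := hasStrictInitialObjects_presented_op hκ
      exists_join := fun I hI X A _ => by
        have key {Z : (KBoolPresented κ)ᵒᵖ} (B : I → Subobject Z) (J : Subobject Z) :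
            IsLUB (Set.range B) J ↔ IsLUB (Set.range fun i => kernel hκ (B i)) (kernel hκ J) := by
          rw [← (subobjectOrderIso hκ Z).isLUB_image', ← Set.range_comp]
          rfl
        -- The join corresponds to the join of the kernel elements; it is stable because the
        -- homomorphism `f` preserves `κ`-ary joins.
        obtain ⟨J, hJ⟩ := kernel_surjective hκ (kSup hI fun i => kernel hκ (A i))
        have hJ' := isLUB_kSup hI fun i => kernel hκ (A i)
        rw [← hJ] at hJ'
        refine ⟨J, (key A J).2 hJ', fun Y f => (key _ _).2 ?_⟩
        simp only [kernel_pullback]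
        exact isLUB_range_map ((IsKPresented κ).ι.map f.unop) hI hJ' }
  isKBooleanPoset := isKBooleanPoset_subobject hκ

end PresentedCategory

end KBool

theorem mainTheorem7 (κ : Cardinal.{u}) (hκ : κ.IsRegular) :
    (∀ (I : Type u), HasCardinalLT I κ → ∀ A : I → KBool κ,
      (∀ i, KBool.IsKPresented κ (A i)) →
        HasProduct A ∧ ∀ c : Fan A, IsLimit c → KBool.IsKPresented κ c.pt) ∧
    IsKExtensive κ (KBool κ)ᵒᵖ ∧
    IsKExtensive κ (KBoolPresented κ)ᵒᵖ ∧
    IsKComplete κ (KBoolPresented κ)ᵒᵖ ∧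
    IsKBooleanCategory κ (KBoolPresented κ)ᵒᵖ := by
  refine ⟨fun I hI A hA => ⟨KBool.hasProduct A, fun c hc => ?_⟩, ?_, ?_,
    KBool.isKComplete_presented_op hκ, KBool.isKBooleanCategory_presented_op hκ⟩
  · have := KBool.isClosedUnderLimitsOfShape_discrete hκ hI
    exact (KBool.IsKPresented κ).prop_of_isLimit hc fun i => hA i.as
  · exact KBool.isKExtensive_op (𝟭 (KBool κ)) (fun _ _ => inferInstance) fun _ _ => inferInstance
  · have := KBool.hasFiniteColimits_presented hκ
    have := KBool.preservesColimitsOfShape_walkingSpan hκ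
    exact KBool.isKExtensive_op (KBool.IsKPresented κ).ι
      (fun I hI => KBool.hasProductsOfShape_presented hκ hI)
      fun I hI => KBool.preservesLimitsOfShape_discrete hκ hI
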